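/- Let $\lambda, c_1, c_2, P, \sigma_0, \beta > 0$, $\alpha > 2$, $\ell \in [0,1]$, and let $N \ge 1$ be an integer. Let $\Phi_x=\{X_i\}_{i\ge 1}$ be a homogeneous Poisson point process on $\mathbb{R}^2$ of density $\lambda$. UAV $i$ is located at $U_i = (X_i, \|X_i\|\tan\Theta_i)\in\mathbb{R}^2\times\mathbb{R}_+$, where (angle-projection-independent locating, APIL, scenario) the elevation angles $\Theta_i$ are i.i.d. copies of a random variable $\Theta$ with values in $[0,\pi/2)$ almost surely. The link from $U_i$ to the user at the origin has channel factor $L_i = 1$ if it is line-of-sight and $L_i=\ell$ otherwise; given its elevation angle $\Theta_i=\theta$, it is line-of-sight with probability $\rho(\theta) = 1/(1+c_2 e^{-c_1\theta})$, independently for different $i$. The elevation angles and line-of-sight indicators are independent of $\Phi_x$ (and of its enumeration). The channel gains $G_i$ are i.i.d. with law $\mathrm{Gamma}(N,1)$ (shape $N$, rate $1$) and independent of everything else. Let $$\omega = \mathbb{E}\Big[\cos^2(\Theta)\big(\rho(\Theta)(1-\ell^{2/\alpha})+\ell^{2/\alpha}\big)\Big], \qquad p^{cf}_{cov} = \mathbb{P}\left[\frac{P\sum_{i\ge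 1} G_i L_i \|U_i\|^{-\alpha}}{\sigma_0}\ge\beta\right],$$ the latter being the cell-free downlink coverage when all UAVs perform non-coherent joint transmission. Then $$p^{cf}_{cov} = 1-\mathcal{L}^{-1}\left\{\frac1s\exp\left[-\frac{\pi\lambda s^{2/\alpha}\omega}{(N-1)!}\,\Gamma\!\left(N+\tfrac{2}{\alpha}\right)\Gamma\!\left(1-\tfrac{2}{\alpha}\right)\right]\right\}\left(\frac{\beta\sigma_0}{P}\right),$$ where for a function $F$ holomorphic on $\{\mathrm{Re}\, s>0\}$ the inverse Laplace transform is $\mathcal{L}^{-1}\{F\}(t) = \lim_{T\to\infty}\frac{1}{2\pi i}\int_{\gamma-iT}^{\gamma+iT} e^{st}F(s)\,ds$ (for any $\gamma>0$; here the limit exists and does not depend on $\gamma$), and $s^{2/\alpha}$ is the principal power. If $\alpha=4$, then moreover $$p^{cf}_{cov} = \mathrm{erf}\left(\frac{\pi^{3/2}\lambda\omega}{2(N-1)!}\sqrt{\frac{P}{\beta\sigma_0}}\;\Gamma\!\left(N+\tfrac12\right)\right), \qquad \mathrm{erf}(z)=\frac{2}{\sqrt\pi}\int_0^z e^{-t^2}\,dt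 .$$ -/

import Mathlib

open MeasureTheory ProbabilityTheory Filter Topology
open scoped ENNReal NNReal

namespace UAV

noncomputable section

/-- The ground plane `ℝ²` with its Euclidean norm. -/
abbrev Plane : Type := EuclideanSpace ℝ (Fin 2)

/-- Three-dimensional space `ℝ² × ℝ` with its Euclidean norm `√(‖x‖² + h²)`. -/
abbrev Space : Type := WithLp 2 (Plane × ℝ)

/-- The number of points of the configuration `{x₀, x₁, …}` that lie in `B`. -/
def count {Ω E : Type*} (X : ℕ → Ω → E) (B : Set E) (w : Ω) : ℕ∞ :=
  {i : ℕ | X i w ∈ B}.encard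

/-- `X 0, X 1, …` is a (measurable) enumeration, without repetition, of the points of a Poisson
point process with intensity measure `Λ`: the number of points in a measurable set `B` with
`Λ B < ∞` is Poisson distributed with mean `Λ B`, and the numbers of points in finitely many
pairwise disjoint such sets are independent. -/
structure IsPoissonProcess {Ω E : Type*} [MeasurableSpace Ω] [MeasurableSpace E]
    (X : ℕ → Ω → E) (Λ : Measure E) (μ : Measure Ω) : Prop where
  measurable : ∀ i, Measurable (X i)
  simple : ∀ᵐ w ∂μ, Function.Injective fun i => X i w
  count_law : ∀ B : Set E, MeasurableSet B → Λ B < ∞ →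
    HasLaw (count X B) ((poissonMeasure (Λ B).toNNReal).map fun n : ℕ => (n : ℕ∞)) μ
  count_indep : ∀ (n : ℕ) (B : Fin n → Set E), (∀ j, MeasurableSet (B j)) →
    (∀ j, Λ (B j) < ∞) → Pairwise (fun j k => Disjoint (B j) (B k)) →
    iIndepFun (fun j => count X (B j)) μ

/-- The line-of-sight probability `ρ(θ) = 1 / (1 + c₂ exp(-c₁ θ))` at elevation angle `θ`. -/
def losProb (c₁ c₂ θ : ℝ) : ℝ := 1 / (1 + c₂ * Real.exp (-c₁ * θ))

/-- Position `U = (x, ‖x‖ tan θ)` of the UAV with ground projection `x`, elevation angle `θ`. -/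
def position (x : Plane) (θ : ℝ) : Space := WithLp.toLp 2 (x, ‖x‖ * Real.tan θ)

/-- The channel factor `L ∈ {1, ℓ}`: it is `1` on a line-of-sight link and `ℓ` otherwise. -/
def channelFactor (ℓ : ℝ) (los : Bool) : ℝ := if los = true then 1 else ℓ

/-- A UAV network in the angle-projection-independent locating (APIL) scenario. UAV `i` has ground
projection `X i`, elevation angle `Θ i`, fading gain `G i` (under beamforming with `N` antennas),
and `LoS i` tells whether its link to the origin is line-of-sight. `ν` is the common law of the
elevation angles, and `lam` is the density of the projections. -/
structure IsAPILNetwork {Ω : Type*} [MeasurableSpace Ω] (μ : Measure Ω)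
    (X : ℕ → Ω → Plane) (Θ : ℕ → Ω → ℝ) (LoS : ℕ → Ω → Bool) (G : ℕ → Ω → ℝ)
    (ν : Measure ℝ) (lam c₁ c₂ : ℝ) (N : ℕ) : Prop where
  /-- The projections form a homogeneous Poisson point process of density `lam`. -/
  projections : IsPoissonProcess X (ENNReal.ofReal lam • (volume : Measure Plane)) μ
  angle_measurable : ∀ i, Measurable (Θ i)
  los_measurable : ∀ i, Measurable (LoS i)
  gain_measurable : ∀ i, Measurable (G i)
  angle_law : ∀ i, HasLaw (Θ i) ν μ
  /-- Elevation angles lie in `[0, π/2)` almost surely, so that all altitudes are finite. -/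
  angle_mem : ∀ᵐ θ ∂ν, θ ∈ Set.Ico 0 (Real.pi / 2)
  /-- Given the elevation angle `θ`, a link is line-of-sight with probability `ρ(θ)`. -/
  los_law : ∀ i (B : Set ℝ), MeasurableSet B →
    μ {w | Θ i w ∈ B ∧ LoS i w = true} = ∫⁻ θ in B, ENNReal.ofReal (losProb c₁ c₂ θ) ∂ν
  /-- The pairs (elevation angle, line-of-sight indicator) of distinct UAVs are independent. -/
  mark_indep : iIndepFun (fun i w => (Θ i w, LoS i w)) μ
  /-- The elevation angles and line-of-sight indicators are independent of the projections. -/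
  mark_indep_projections :
    IndepFun (fun w i => (Θ i w, LoS i w)) (fun w i => X i w) μ
  /-- The fading gains are i.i.d. with law `Gamma(N, 1)`. -/
  gain_law : ∀ i, HasLaw (G i) (gammaMeasure N 1) μ
  gain_indep : iIndepFun G μ
  /-- The fading gains are independent of everything else. -/
  gain_indep_rest :
    IndepFun (fun w i => G i w) (fun w i => (X i w, Θ i w, LoS i w)) μ

/-- `S(w) = ∑ᵢ Gᵢ Lᵢ ‖Uᵢ‖^(-α) ∈ [0, ∞]`, the sum over all UAVs. -/
def shotSignal {Ω : Type*} (X : ℕ → Ω → Plane) (Θ : ℕ → Ω → ℝ) (LoS : ℕ → Ω → Bool)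
    (G : ℕ → Ω → ℝ) (α ℓ : ℝ) (w : Ω) : ℝ≥0∞ :=
  ∑' i, ENNReal.ofReal
    (G i w * channelFactor ℓ (LoS i w) * ‖position (X i w) (Θ i w)‖ ^ (-α))

/-- The cell-free downlink coverage `ℙ[P ∑ᵢ Gᵢ Lᵢ ‖Uᵢ‖^(-α) / σ₀ ≥ β]` under non-coherent joint
transmission from all UAVs. -/
def cellFreeCoverage {Ω : Type*} [MeasurableSpace Ω] (μ : Measure Ω)
    (X : ℕ → Ω → Plane) (Θ : ℕ → Ω → ℝ) (LoS : ℕ → Ω → Bool)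
    (G : ℕ → Ω → ℝ) (α ℓ P σ₀ β : ℝ) : ℝ :=
  μ.real {w | ENNReal.ofReal β ≤
    ENNReal.ofReal P * shotSignal X Θ LoS G α ℓ w / ENNReal.ofReal σ₀}

/-- `ω = 𝔼[cos²(Θ) (ρ(Θ) (1 - ℓ^(2/α)) + ℓ^(2/α))]`, where `Θ` has law `ν`. -/
def omega (ν : Measure ℝ) (c₁ c₂ α ℓ : ℝ) : ℝ :=
  ∫ θ, Real.cos θ ^ 2 *
    (losProb c₁ c₂ θ * (1 - ℓ ^ (2 / α)) + ℓ ^ (2 / α)) ∂ν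

/-- The value at `t` of the inverse Laplace transform of `F` is `v`: `F` is holomorphic on the
half-plane `Re s > a`, and for every `γ > a` the principal value of the Bromwich integral
`(2πi)⁻¹ ∫_{γ - i∞}^{γ + i∞} e^{st} F(s) ds` converges to `v`. -/
def HasInverseLaplaceAt (F : ℂ → ℂ) (a t : ℝ) (v : ℂ) : Prop :=
  DifferentiableOn ℂ F {s : ℂ | a < s.re} ∧
  ∀ γ : ℝ, a < γ → Tendsto
    (fun T : ℝ => (1 / (2 * (Real.pi : ℂ))) *
      ∫ y in (-T)..T, Complex.exp (((γ : ℂ) + y * Complex.I) * t) *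
        F ((γ : ℂ) + y * Complex.I))
    atTop (𝓝 v)

/-- The error function `erf z = (2/√π) ∫₀ᶻ e^{-t²} dt`. -/
def erf (z : ℝ) : ℝ := 2 / √Real.pi * ∫ t in (0 : ℝ)..z, Real.exp (-t ^ 2)

end

end UAV

/-! The received signal `S` is a shot noise: a sum over Poisson points of a function of the point
and of independent marks. Averaging the marks point by point and applying the Laplace functional of
the Poisson process gives `E e^{-sS} = exp (-λ E ∫ (1 - exp (-s G L ‖U‖^{-α})) dx)`.

The choice of altitude makes `‖U‖ = ‖x‖ / cos Θ`, so the exponent is `c ‖x‖^{-α}` with `c = s G L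
cos^α Θ`. The planar integral is then `π c^δ Γ(1 - δ)`, where `δ = 2/α < 1`. The expectation of
`c^δ` factorises into `s^δ`, the gamma moment `E G^δ = Γ(N + δ) / (N - 1)!`, and `E[cos² Θ L^δ] =
ω`. Hence `E e^{-sS} = exp (-K s^δ)`: the law of `S` is one-sided stable of index `δ`
(`IsAPILNetwork.lintegral_expNeg_shotSignal`).

Coverage is `1 - P(S < t)` at `t = β σ₀ / P`, and `t ↦ P(S < t)` has Laplace transform `s⁻¹ exp (-K
s^δ)`, first for real `s` and then, by analytic continuation, for `Re s > 0`. On vertical lines this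
decays like `exp (-k |y|^δ)`, so the Bromwich integral converges absolutely and Fourier inversion
applies (`bromwich_integral_stableTransform`).

For `α = 4` the index is `1/2`, and `(K / (2x))²` with `x` half-Gaussian has the same Laplace
transform. Both distribution functions are values of the same Bromwich integral, so they agree, and
the second one is an `erf`. -/

namespace UAV

/-! ### The exponential `e^{-x}` on `[0, ∞]` -/

/-- `e^{-x}` for `x ∈ [0, ∞]`, with `e^{-∞} = 0`. -/
noncomputable def expNeg (x : ℝ≥0∞) : ℝ≥0∞ := EReal.exp (-(x : EReal))

@[simp] lemma expNeg_zero : expNeg 0 = 1 := by simp [expNeg]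

@[simp] lemma expNeg_top : expNeg ∞ = 0 := by simp [expNeg]

lemma expNeg_add (x y : ℝ≥0∞) : expNeg (x + y) = expNeg x * expNeg y := by
  have h : -((x : EReal) + (y : EReal)) = -(x : EReal) + -(y : EReal) := by
    rw [EReal.neg_add (Or.inl (by simp)) (Or.inr (by simp)), sub_eq_add_neg]
  rw [expNeg, EReal.coe_ennreal_add, h, EReal.exp_add, expNeg, expNeg]

lemma expNeg_ofReal {x : ℝ} (hx : 0 ≤ x) :
    expNeg (ENNReal.ofReal x) = ENNReal.ofReal (Real.exp (-x)) := by
  rw [expNeg, EReal.coe_ennreal_ofReal, max_eq_left hx, ← EReal.coe_neg, EReal.exp_coe]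

lemma expNeg_of_ne_top {x : ℝ≥0∞} (hx : x ≠ ∞) :
    expNeg x = ENNReal.ofReal (Real.exp (-x.toReal)) := by
  rw [← expNeg_ofReal ENNReal.toReal_nonneg, ENNReal.ofReal_toReal hx]

lemma antitone_expNeg : Antitone expNeg := fun x y h =>
  EReal.exp_monotone (EReal.neg_le_neg_iff.2 (by exact_mod_cast h))

lemma expNeg_le_one (x : ℝ≥0∞) : expNeg x ≤ 1 := by
  simpa using antitone_expNeg (zero_le (a := x))

lemma continuous_expNeg : Continuous expNeg :=
  ENNReal.continuous_exp.comp (continuous_neg.comp continuous_coe_ennreal_ereal)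

@[fun_prop] lemma measurable_expNeg : Measurable expNeg := continuous_expNeg.measurable

lemma expNeg_sum {ι : Type*} (s : Finset ι) (a : ι → ℝ≥0∞) :
    expNeg (∑ i ∈ s, a i) = ∏ i ∈ s, expNeg (a i) := by
  classical
  induction s using Finset.induction_on with
  | empty => simp
  | insert i s hi ih => rw [Finset.sum_insert hi, Finset.prod_insert hi, expNeg_add, ih]

lemma tendsto_prod_expNeg (a : ℕ → ℝ≥0∞) :
    Tendsto (fun n => ∏ i ∈ Finset.range n, expNeg (a i)) atTop (𝓝 (expNeg (∑' i, a i))) := by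
  simp_rw [← expNeg_sum]
  exact (continuous_expNeg.tendsto _).comp ENNReal.summable.hasSum.tendsto_sum_nat

/-- `-log y ∈ [0, ∞]` for `y ∈ [0, 1]`. -/
noncomputable def negLog (y : ℝ≥0∞) : ℝ≥0∞ := (-ENNReal.log y).toENNReal

/-- This lets a factor averaged over the marks be written as `e^{-u}`, so that the Laplace
functional applies to it. The value `y = 0` is covered by `u = ∞`. -/
lemma expNeg_negLog {y : ℝ≥0∞} (hy : y ≤ 1) : expNeg (negLog y) = y := by
  have h : 0 ≤ -ENNReal.log y := by
    rw [EReal.neg_nonneg]; exact ENNReal.log_le_zero_iff.2 hy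
  rw [expNeg, negLog, EReal.coe_toENNReal h, neg_neg, ENNReal.exp_log]

@[fun_prop] lemma measurable_negLog : Measurable negLog :=
  measurable_ereal_toENNReal.comp (continuous_neg.measurable.comp ENNReal.measurable_log)

lemma expNeg_nat_mul (a : ℝ≥0∞) (n : ℕ) : expNeg (a * n) = expNeg a ^ n := by
  induction n with
  | zero => simp
  | succ n ih => rw [Nat.cast_succ, mul_add, mul_one, expNeg_add, ih, pow_succ]

/-- This is the Poisson generating function `E q^n = exp (-r (1 - q))` at `q = e^{-a}`, summed by
the exponential series; `a = ∞`, that is `q = 0`, is allowed. -/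
lemma lintegral_expNeg_poissonMeasure (r : ℝ≥0) (a : ℝ≥0∞) :
    ∫⁻ n : ℕ, expNeg (a * n) ∂poissonMeasure r = expNeg (r * (1 - expNeg a)) := by
  obtain ⟨q, hq⟩ : ∃ q : ℝ≥0, expNeg a = q :=
    ⟨(expNeg a).toNNReal, (ENNReal.coe_toNNReal ((expNeg_le_one a).trans_lt (by simp)).ne).symm⟩
  have hq1 : q ≤ 1 := by exact_mod_cast hq ▸ expNeg_le_one a
  have hR : expNeg (r * (1 - expNeg a)) = ENNReal.ofReal (Real.exp (-(r * (1 - q)))) := by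
    rw [hq, ← expNeg_ofReal (mul_nonneg r.coe_nonneg (sub_nonneg.2 (by exact_mod_cast hq1))),
      ENNReal.ofReal_mul r.coe_nonneg, ENNReal.ofReal_sub _ q.coe_nonneg]
    simp
  rw [hR, lintegral_countable']
  simp_rw [expNeg_nat_mul, hq, poissonMeasure_singleton]
  have h1 : ∀ n : ℕ, (q : ℝ≥0∞) ^ n * ENNReal.ofReal (Real.exp (-r) * r ^ n / n.factorial) =
      ENNReal.ofReal (Real.exp (-r) * ((r * q : ℝ) ^ n / n.factorial)) := fun n => by
    rw [← ENNReal.ofReal_coe_nnreal, ← ENNReal.ofReal_pow q.coe_nonneg, ← ENNReal.ofReal_mul (by positivity)]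
    congr 1
    rw [mul_pow]; ring
  simp_rw [h1]
  have hs := (NormedSpace.expSeries_div_hasSum_exp (r * q : ℝ)).mul_left (Real.exp (-r))
  rw [← Real.exp_eq_exp_ℝ, ← Real.exp_add] at hs
  rw [← ENNReal.ofReal_tsum_of_nonneg (fun n => by positivity) hs.summable, hs.tsum_eq]
  congr 2; ring

lemma tsum_indicator_one_eq_count {Ω E : Type*} (X : ℕ → Ω → E) (B : Set E) (w : Ω) :
    ∑' i, B.indicator (fun _ => (1 : ℝ≥0∞)) (X i w) = (count X B w : ℝ≥0∞) := by
  rw [count, ← ENNReal.tsum_set_one, tsum_subtype {i | X i w ∈ B} fun _ => (1 : ℝ≥0∞)]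
  rfl

/-! ### Laplace functional of a Poisson process -/

section Poisson

variable {Ω E : Type*} [MeasurableSpace Ω] [MeasurableSpace E] {X : ℕ → Ω → E} {Λ : Measure E}
  {μ : Measure Ω}

lemma IsPoissonProcess.lintegral_expNeg_mul_count (hX : IsPoissonProcess X Λ μ) {B : Set E}
    (hB : MeasurableSet B) (hΛ : Λ B < ∞) (a : ℝ≥0∞) :
    ∫⁻ w, expNeg (a * (count X B w : ℝ≥0∞)) ∂μ = expNeg (Λ B * (1 - expNeg a)) := by
  have hl := hX.count_law B hB hΛ
  have hm : Measurable fun n : ℕ∞ => expNeg (a * (n : ℝ≥0∞)) := measurable_of_countable _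
  rw [← lintegral_map' (f := fun n : ℕ∞ => expNeg (a * (n : ℝ≥0∞))) hm.aemeasurable hl.aemeasurable,
    hl.map_eq, lintegral_map hm (measurable_of_countable _)]
  simp only [ENat.toENNReal_coe]
  rw [lintegral_expNeg_poissonMeasure, ENNReal.coe_toNNReal hΛ.ne]

/-- Laplace functional of a Poisson process on simple functions of finite-measure support. -/
lemma IsPoissonProcess.laplaceFunctional_simpleFunc (hX : IsPoissonProcess X Λ μ)
    (f : SimpleFunc E ℝ≥0∞) (hf : ∀ a, a ≠ 0 → Λ (f ⁻¹' {a}) < ∞) :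
    ∫⁻ w, expNeg (∑' i, f (X i w)) ∂μ = expNeg (∫⁻ x, (1 - expNeg (f x)) ∂Λ) := by
  classical
  set S : Finset ℝ≥0∞ := f.range.filter (· ≠ 0)
  -- The decomposition over level sets is needed twice: with `g = id` for the sum over points, and
  -- with `g a = 1 - e^{-a}` for the integral against `Λ`. The level set of `0` may have infinite
  -- measure; `g 0 = 0` removes it.
  have hsum : ∀ (g : ℝ≥0∞ → ℝ≥0∞), g 0 = 0 → ∀ x, g (f x) =
      ∑ a ∈ S, g a * (f ⁻¹' {a}).indicator (fun _ => (1 : ℝ≥0∞)) x := by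
    intro g hg x
    by_cases h0 : f x = 0
    · rw [h0, hg]
      refine (Finset.sum_eq_zero fun a ha => ?_).symm
      rw [Set.indicator_of_notMem, mul_zero]
      simp only [Set.mem_preimage, h0, Set.mem_singleton_iff]
      exact fun h => (Finset.mem_filter.1 ha).2 h.symm
    · rw [Finset.sum_eq_single (f x)]
      · simp
      · intro b _ hb
        rw [Set.indicator_of_notMem, mul_zero]
        simpa using hb.symm
      · intro h
        exact absurd (Finset.mem_filter.2 ⟨f.mem_range_self x, h0⟩) h
  set e : Fin S.card ≃ S := S.equivFin.symm
  have hne : ∀ j, (e j : ℝ≥0∞) ≠ 0 := fun j => (Finset.mem_filter.1 (e j).2).2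
  have hmeas : ∀ j, MeasurableSet (f ⁻¹' {(e j : ℝ≥0∞)}) := fun j => f.measurableSet_fiber _
  have hreindex : ∀ g : ℝ≥0∞ → ℝ≥0∞, ∑ a ∈ S, g a = ∑ j, g (e j) := fun g => by
    rw [← Finset.sum_coe_sort S g]
    exact (Equiv.sum_comp e fun a : S => g a).symm
  -- The sum over points is a combination of the counts in disjoint level sets, so its exponential
  -- is a product of independent factors.
  have hcount : ∀ w, expNeg (∑' i, f (X i w)) =
      ∏ j, expNeg ((e j : ℝ≥0∞) * (count X (f ⁻¹' {(e j : ℝ≥0∞)}) w : ℝ≥0∞)) := fun w => by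
    have h : ∑' i, f (X i w) =
        ∑' i, ∑ a ∈ S, a * (f ⁻¹' {a}).indicator (fun _ => (1 : ℝ≥0∞)) (X i w) :=
      tsum_congr fun i => hsum id rfl (X i w)
    rw [← expNeg_sum, h, Summable.tsum_finsetSum fun _ _ => ENNReal.summable]
    simp_rw [ENNReal.tsum_mul_left, tsum_indicator_one_eq_count]
    rw [hreindex]
  have hind : iIndepFun
      (fun j w => expNeg ((e j : ℝ≥0∞) * (count X (f ⁻¹' {(e j : ℝ≥0∞)}) w : ℝ≥0∞))) μ := by
    refine (hX.count_indep _ (fun j => f ⁻¹' {(e j : ℝ≥0∞)}) hmeas (fun j => hf _ (hne j))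
      fun j k hjk => ?_).comp (fun j n => expNeg ((e j : ℝ≥0∞) * ((n : ℕ∞) : ℝ≥0∞)))
      fun j => measurable_of_countable _
    refine Disjoint.preimage _ (Set.disjoint_singleton.2 fun h => hjk ?_)
    exact e.injective (Subtype.ext h)
  simp_rw [hcount]
  rw [lintegral_prod_eq_prod_lintegral_of_indepFun _ _ hind]
  · simp_rw [fun j => hX.lintegral_expNeg_mul_count (hmeas j) (hf _ (hne j)) (e j)]
    rw [← expNeg_sum, lintegral_congr fun x => hsum (fun a => 1 - expNeg a) (by simp) x,
      lintegral_finsetSum, hreindex]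
    · congr 1
      refine Finset.sum_congr rfl fun j _ => ?_
      rw [lintegral_const_mul _ (measurable_const.indicator (hmeas j)),
        lintegral_indicator (hmeas j), setLIntegral_const, one_mul, mul_comm]
    · exact fun a _ => (measurable_const.indicator (f.measurableSet_fiber a)).const_mul _
  · intro j
    simp_rw [← tsum_indicator_one_eq_count]
    exact measurable_expNeg.comp (Measurable.const_mul (Measurable.tsum fun i =>
      (measurable_const.indicator (hmeas j)).comp (hX.measurable i)) _)

/-- Laplace functional of a Poisson process. -/
theorem IsPoissonProcess.laplaceFunctional [IsProbabilityMeasure μ] [SigmaFinite Λ]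
    (hX : IsPoissonProcess X Λ μ) {u : E → ℝ≥0∞} (hu : Measurable u) :
    ∫⁻ w, expNeg (∑' i, u (X i w)) ∂μ = expNeg (∫⁻ x, (1 - expNeg (u x)) ∂Λ) := by
  -- Cutting the simple approximations off to the spanning sets of `Λ` gives their nonzero level
  -- sets finite measure while keeping the sequence monotone.
  set f : ℕ → SimpleFunc E ℝ≥0∞ := fun n =>
    (SimpleFunc.eapprox u n).restrict (spanningSets Λ n) with hf_def
  have hf_apply : ∀ n x, f n x = (spanningSets Λ n).indicator (SimpleFunc.eapprox u n) x :=
    fun n x => by rw [SimpleFunc.restrict_apply _ (measurableSet_spanningSets Λ n)]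
  have hmono : ∀ x, Monotone fun n => f n x := fun x n m hnm => by
    simp only [hf_apply]
    refine (Set.indicator_le_indicator_of_subset (monotone_spanningSets Λ hnm)
      (fun _ => zero_le) x).trans (Set.indicator_le_indicator ?_)
    exact SimpleFunc.monotone_eapprox u hnm x
  have htend : ∀ x, Tendsto (fun n => f n x) atTop (𝓝 (u x)) := fun x => by
    refine (SimpleFunc.tendsto_eapprox hu x).congr' ?_
    filter_upwards [eventually_ge_atTop (spanningSetsIndex Λ x)] with n hn
    rw [hf_apply, Set.indicator_of_mem]
    exact mem_spanningSets_of_index_le Λ x hn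
  have hle : ∀ n x, f n x ≤ u x := fun n x => (hmono x).ge_of_tendsto (htend x) n
  have hfin : ∀ n a, a ≠ 0 → Λ (f n ⁻¹' {a}) < ∞ := fun n a ha => by
    refine (measure_mono fun x hx => ?_).trans_lt (measure_spanningSets_lt_top Λ n)
    by_contra h
    refine ha ?_
    rw [← (show f n x = a from hx), hf_apply, Set.indicator_of_notMem h]
  have hL : Tendsto (fun n => ∫⁻ w, expNeg (∑' i, f n (X i w)) ∂μ) atTop
      (𝓝 (∫⁻ w, expNeg (∑' i, u (X i w)) ∂μ)) := by
    refine tendsto_lintegral_of_dominated_convergence (fun _ => 1) (fun n => ?_)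
      (fun n => ae_of_all _ fun w => expNeg_le_one _) (by simp) (ae_of_all _ fun w => ?_)
    · have := hX.measurable
      exact measurable_expNeg.comp (Measurable.tsum fun i => (f n).measurable.comp (this i))
    · refine (continuous_expNeg.tendsto _).comp ?_
      -- Monotone convergence for the counting measure on the indices moves the limit through the
      -- infinite sum.
      have h := lintegral_tendsto_of_tendsto_of_monotone (μ := Measure.count)
        (f := fun n i => f n (X i w)) (F := fun i => u (X i w))
        (fun n => (measurable_of_countable _).aemeasurable)
        (ae_of_all _ fun i => hmono (X i w)) (ae_of_all _ fun i => htend (X i w))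
      simpa [lintegral_count] using h
  have hR : Tendsto (fun n => expNeg (∫⁻ x, (1 - expNeg (f n x)) ∂Λ)) atTop
      (𝓝 (expNeg (∫⁻ x, (1 - expNeg (u x)) ∂Λ))) := by
    refine (continuous_expNeg.tendsto _).comp ?_
    refine lintegral_tendsto_of_tendsto_of_monotone (fun n => ?_) (ae_of_all _ fun x n m h => ?_)
      (ae_of_all _ fun x => ?_)
    · exact (measurable_const.sub (measurable_expNeg.comp (f n).measurable)).aemeasurable
    · exact tsub_le_tsub_left (antitone_expNeg (hmono x h)) _
    · exact ENNReal.Tendsto.sub tendsto_const_nhds ((continuous_expNeg.tendsto _).comp (htend x))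
        (Or.inl (by simp))
  refine tendsto_nhds_unique hL (hR.congr fun n => ?_)
  exact (hX.laplaceFunctional_simpleFunc (f n) (hfin n)).symm

end Poisson

/-! ### Averaging over independent marks -/

section Marks

variable {Ω A B : Type*} [MeasurableSpace Ω] [MeasurableSpace A] [MeasurableSpace B]
  {μ : Measure Ω}

/-- Independent identically distributed marks `V i` that are independent of the sequence `W` can
be integrated out one by one. -/
theorem lintegral_prod_iid_marks {V : ℕ → Ω → A} {W : ℕ → Ω → B} {η : Measure A}
    (hVm : ∀ i, Measurable (V i)) (hWm : ∀ i, Measurable (W i))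
    (hV : iIndepFun V μ) (hlaw : ∀ i, HasLaw (V i) η μ)
    (hVW : IndepFun (fun w i => V i w) (fun w i => W i w) μ)
    {h : B × A → ℝ≥0∞} (hh : Measurable h) (s : Finset ℕ) :
    ∫⁻ w, ∏ i ∈ s, h (W i w, V i w) ∂μ = ∫⁻ w, ∏ i ∈ s, ∫⁻ a, h (W i w, a) ∂η ∂μ := by
  have := hV.isProbabilityMeasure
  have hVm' : Measurable fun w i => V i w := measurable_pi_lambda _ hVm
  have hWm' : Measurable fun w i => W i w := measurable_pi_lambda _ hWm
  have hη : SFinite η := by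
    rw [← (hlaw 0).map_eq]; infer_instance
  have hg : Measurable fun p : (ℕ → A) × (ℕ → B) => ∏ i ∈ s, h (p.2 i, p.1 i) := by
    fun_prop
  have hφ : Measurable fun b => ∫⁻ a, h (b, a) ∂η := hh.lintegral_prod_right'
  -- The joint law of the two sequences is a product, so `W` may be frozen at `b`; the factors are
  -- then functions of the independent `V i`.
  have hfix : ∀ b : ℕ → B, ∫⁻ v, ∏ i ∈ s, h (b i, v i) ∂(μ.map fun w i => V i w) =
      ∏ i ∈ s, ∫⁻ a, h (b i, a) ∂η := fun b => by
    rw [lintegral_map (by fun_prop) hVm', lintegral_prod_eq_prod_lintegral_of_indepFun s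
      (fun i w => h (b i, V i w)) (hV.comp (fun i a => h (b i, a)) fun i => by fun_prop)
      fun i => by fun_prop]
    refine Finset.prod_congr rfl fun i _ => ?_
    rw [← (hlaw i).map_eq, lintegral_map (by fun_prop) (hVm i)]
  calc ∫⁻ w, ∏ i ∈ s, h (W i w, V i w) ∂μ
      = ∫⁻ p, ∏ i ∈ s, h (p.2 i, p.1 i) ∂(μ.map fun w => (fun i => V i w, fun i => W i w)) := by
        rw [lintegral_map hg (hVm'.prodMk hWm')]
    _ = ∫⁻ b, ∫⁻ v, ∏ i ∈ s, h (b i, v i) ∂(μ.map fun w i => V i w) ∂(μ.map fun w i => W i w) := by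
        rw [(indepFun_iff_map_prod_eq_prod_map_map hVm'.aemeasurable hWm'.aemeasurable).1 hVW,
          lintegral_prod_symm _ hg.aemeasurable]
    _ = ∫⁻ w, ∏ i ∈ s, ∫⁻ a, h (W i w, a) ∂η ∂μ := by
        simp_rw [hfix]
        rw [lintegral_map (by fun_prop) hWm']

end Marks

/-! ### The Laplace transform of the signal as an integral over marks and plane -/

section Network

variable {Ω : Type*} [MeasurableSpace Ω] {μ : Measure Ω} {X : ℕ → Ω → Plane}
  {Θ : ℕ → Ω → ℝ} {LoS : ℕ → Ω → Bool} {G : ℕ → Ω → ℝ} {ν : Measure ℝ} {lam c₁ c₂ : ℝ} {N : ℕ}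

/-- The power received from a UAV with projection `x`, elevation angle `m.1`, line-of-sight
indicator `m.2` and channel gain `g`. -/
noncomputable def receivedPower (α ℓ : ℝ) (x : Plane) (m : ℝ × Bool) (g : ℝ) : ℝ≥0∞ :=
  ENNReal.ofReal (g * channelFactor ℓ m.2 * ‖position x m.1‖ ^ (-α))

lemma measurable_channelFactor (ℓ : ℝ) : Measurable (channelFactor ℓ) := measurable_of_countable _

lemma norm_position_sq (x : Plane) (θ : ℝ) :
    ‖position x θ‖ ^ 2 = ‖x‖ ^ 2 + (‖x‖ * Real.tan θ) ^ 2 := by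
  rw [position, WithLp.prod_norm_sq_eq_of_L2, Real.norm_eq_abs, sq_abs]
  rfl

/-- From `1 + tan² = 1 / cos²`: in this scenario the elevation angle only rescales the planar
distance, so the spatial path loss is a planar one times `cos^α θ`. -/
lemma norm_position (x : Plane) {θ : ℝ} (hθ : 0 < Real.cos θ) :
    ‖position x θ‖ = ‖x‖ / Real.cos θ := by
  have h : ‖position x θ‖ ^ 2 = (‖x‖ / Real.cos θ) ^ 2 := by
    rw [norm_position_sq, Real.tan_eq_sin_div_cos]
    field_simp
    linear_combination ‖x‖ ^ 2 * Real.cos_sq_add_sin_sq θ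
  rwa [sq_eq_sq₀ (norm_nonneg _) (by positivity)] at h

lemma measurable_norm_position : Measurable fun p : Plane × ℝ => ‖position p.1 p.2‖ := by
  have h : (fun p : Plane × ℝ => ‖position p.1 p.2‖) =
      fun p => √(‖p.1‖ ^ 2 + (‖p.1‖ * Real.tan p.2) ^ 2) := by
    funext p
    rw [← Real.sqrt_sq (norm_nonneg (position _ _)), norm_position_sq]
  have htan : Measurable Real.tan := by
    rw [funext Real.tan_eq_sin_div_cos]
    fun_prop
  rw [h]
  fun_prop

lemma measurable_receivedPower (α ℓ : ℝ) :
    Measurable fun p : (Plane × (ℝ × Bool)) × ℝ => receivedPower α ℓ p.1.1 p.1.2 p.2 := by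
  have h1 : Measurable fun p : (Plane × (ℝ × Bool)) × ℝ => channelFactor ℓ p.1.2.2 :=
    (measurable_channelFactor ℓ).comp (by fun_prop)
  have h2 : Measurable fun p : (Plane × (ℝ × Bool)) × ℝ => ‖position p.1.1 p.1.2.1‖ :=
    measurable_norm_position.comp (f := fun p : (Plane × (ℝ × Bool)) × ℝ => (p.1.1, p.1.2.1))
      (by fun_prop)
  exact ENNReal.measurable_ofReal.comp ((measurable_snd.mul h1).mul (h2.pow_const _))

lemma IsAPILNetwork.measurable_mark (hnet : IsAPILNetwork μ X Θ LoS G ν lam c₁ c₂ N) (i : ℕ) :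
    Measurable fun w => (Θ i w, LoS i w) :=
  (hnet.angle_measurable i).prodMk (hnet.los_measurable i)

lemma IsAPILNetwork.measurable_shotSignal (hnet : IsAPILNetwork μ X Θ LoS G ν lam c₁ c₂ N)
    (α ℓ : ℝ) : Measurable (shotSignal X Θ LoS G α ℓ) := by
  refine Measurable.tsum fun i => ?_
  exact (measurable_receivedPower α ℓ).comp
    (((hnet.projections.measurable i).prodMk (hnet.measurable_mark i)).prodMk
      (hnet.gain_measurable i))

/-- The joint law of elevation angle and line-of-sight indicator. -/
noncomputable def markLaw (ν : Measure ℝ) (c₁ c₂ : ℝ) : Measure (ℝ × Bool) :=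
  (ν.withDensity fun θ => ENNReal.ofReal (losProb c₁ c₂ θ)).map (fun θ => (θ, true)) +
  (ν.withDensity fun θ => ENNReal.ofReal (1 - losProb c₁ c₂ θ)).map (fun θ => (θ, false))

@[fun_prop] lemma measurable_losProb (c₁ c₂ : ℝ) : Measurable (losProb c₁ c₂) := by
  unfold losProb
  fun_prop

lemma lintegral_markLaw (ν : Measure ℝ) (c₁ c₂ : ℝ) {f : ℝ × Bool → ℝ≥0∞} (hf : Measurable f) :
    ∫⁻ m, f m ∂markLaw ν c₁ c₂ = ∫⁻ θ, (ENNReal.ofReal (losProb c₁ c₂ θ) * f (θ, true) +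
      ENNReal.ofReal (1 - losProb c₁ c₂ θ) * f (θ, false)) ∂ν := by
  rw [markLaw, lintegral_add_measure, lintegral_map hf (by fun_prop),
    lintegral_map hf (by fun_prop), lintegral_withDensity_eq_lintegral_mul _ (by fun_prop)
    (by fun_prop), lintegral_withDensity_eq_lintegral_mul _ (by fun_prop) (by fun_prop),
    ← lintegral_add_left (by fun_prop)]
  rfl

lemma losProb_pos {c₂ : ℝ} (hc₂ : 0 < c₂) (c₁ θ : ℝ) : 0 < losProb c₁ c₂ θ := by
  unfold losProb; positivity

lemma losProb_le_one {c₂ : ℝ} (hc₂ : 0 < c₂) (c₁ θ : ℝ) : losProb c₁ c₂ θ ≤ 1 := by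
  unfold losProb
  rw [div_le_one (by positivity)]
  have : 0 < c₂ * Real.exp (-c₁ * θ) := by positivity
  linarith

/-- A measurable set of pairs splits along the Boolean coordinate. The line-of-sight part is
`los_law`; the other part follows by subtraction from the law of the angle, all masses being finite.
-/
lemma IsAPILNetwork.hasLaw_mark [IsProbabilityMeasure μ]
    (hnet : IsAPILNetwork μ X Θ LoS G ν lam c₁ c₂ N)
    (hc₂ : 0 < c₂) (i : ℕ) : HasLaw (fun w => (Θ i w, LoS i w)) (markLaw ν c₁ c₂) μ := by
  refine ⟨(hnet.measurable_mark i).aemeasurable, ?_⟩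
  ext S hS
  have hm := hnet.angle_measurable i
  have hT : MeasurableSet {θ : ℝ | (θ, true) ∈ S} := measurable_prodMk_right hS
  have hF : MeasurableSet {θ : ℝ | (θ, false) ∈ S} := measurable_prodMk_right hS
  have htrue : ∀ B : Set ℝ, MeasurableSet B → MeasurableSet {w | Θ i w ∈ B ∧ LoS i w = true} :=
    fun B hB => (hm hB).inter (hnet.los_measurable i (measurableSet_singleton true))
  have hfin : ∀ B : Set ℝ, ∫⁻ θ in B, ENNReal.ofReal (losProb c₁ c₂ θ) ∂ν ≠ ∞ := fun B => by
    have : IsProbabilityMeasure ν := (hnet.angle_law i).isProbabilityMeasure_iff.1 inferInstance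
    refine ((lintegral_mono (g := fun _ => 1) fun θ => ?_).trans_lt ?_).ne
    · exact ENNReal.ofReal_le_one.2 (losProb_le_one hc₂ _ _)
    · simp
  have hfalse : ∀ B : Set ℝ, MeasurableSet B → μ {w | Θ i w ∈ B ∧ LoS i w = false} =
      ∫⁻ θ in B, ENNReal.ofReal (1 - losProb c₁ c₂ θ) ∂ν := fun B hB => by
    have hsplit : {w | Θ i w ∈ B ∧ LoS i w = false} =
        (Θ i ⁻¹' B) \ {w | Θ i w ∈ B ∧ LoS i w = true} := by
      ext w; cases h : LoS i w <;> simp [h]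
    rw [hsplit, measure_sdiff (s₂ := {w | Θ i w ∈ B ∧ LoS i w = true}) (s₁ := Θ i ⁻¹' B) (fun w hw => hw.1) (htrue B hB).nullMeasurableSet
      (by rw [hnet.los_law i B hB]; exact hfin B), hnet.los_law i B hB,
      ← Measure.map_apply hm hB, (hnet.angle_law i).map_eq]
    simp_rw [ENNReal.ofReal_sub 1 (losProb_pos hc₂ c₁ _).le, ENNReal.ofReal_one]
    rw [lintegral_sub (by fun_prop) (hfin B) (ae_of_all _ fun θ =>
      ENNReal.ofReal_le_one.2 (losProb_le_one hc₂ _ _)), setLIntegral_const, one_mul]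
  have hsplit : (fun w => (Θ i w, LoS i w)) ⁻¹' S =
      {w | Θ i w ∈ {θ : ℝ | (θ, true) ∈ S} ∧ LoS i w = true} ∪
      {w | Θ i w ∈ {θ : ℝ | (θ, false) ∈ S} ∧ LoS i w = false} := by
    ext w; cases h : LoS i w <;> simp [h]
  have hdisj : Disjoint {w | Θ i w ∈ {θ : ℝ | (θ, true) ∈ S} ∧ LoS i w = true}
      {w | Θ i w ∈ {θ : ℝ | (θ, false) ∈ S} ∧ LoS i w = false} :=
    Set.disjoint_left.2 fun w h1 h2 => by simp [h1.2] at h2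
  rw [Measure.map_apply (hnet.measurable_mark i) hS, hsplit,
    measure_union' hdisj (htrue _ hT), hnet.los_law i _ hT, hfalse _ hF, markLaw,
    Measure.add_apply, Measure.map_apply (by fun_prop) hS, Measure.map_apply (by fun_prop) hS,
    withDensity_apply _ (measurable_prodMk_right hS),
    withDensity_apply _ (measurable_prodMk_right hS)]
  rfl

/-- Laplace functional of the received signal in terms of the mean measure of the received
powers. -/
theorem IsAPILNetwork.lintegral_expNeg_mul_shotSignal [IsProbabilityMeasure μ]
    (hnet : IsAPILNetwork μ X Θ LoS G ν lam c₁ c₂ N) (hc₂ : 0 < c₂) (hN : 1 ≤ N) (α ℓ : ℝ)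
    {s : ℝ≥0∞} :
    ∫⁻ w, expNeg (s * shotSignal X Θ LoS G α ℓ w) ∂μ =
      expNeg (ENNReal.ofReal lam * ∫⁻ m, ∫⁻ g, (∫⁻ x : Plane,
        (1 - expNeg (s * receivedPower α ℓ x m g))) ∂gammaMeasure N 1 ∂markLaw ν c₁ c₂) := by
  have hprob : IsProbabilityMeasure (gammaMeasure N 1) :=
    isProbabilityMeasure_gammaMeasure (by exact_mod_cast hN) one_pos
  have hprob' : IsProbabilityMeasure (markLaw ν c₁ c₂) :=
    (hnet.hasLaw_mark hc₂ 0).isProbabilityMeasure_iff.1 inferInstance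
  have hσ : SigmaFinite (ENNReal.ofReal lam • (volume : Measure Plane)) :=
    inferInstanceAs (SigmaFinite (lam.toNNReal • (volume : Measure Plane)))
  have hrm := measurable_receivedPower α ℓ
  set f : (Plane × (ℝ × Bool)) × ℝ → ℝ≥0∞ :=
    fun p => expNeg (s * receivedPower α ℓ p.1.1 p.1.2 p.2) with hf_def
  have hf : Measurable f := measurable_expNeg.comp (hrm.const_mul s)
  set φ₁ : Plane × (ℝ × Bool) → ℝ≥0∞ := fun p => ∫⁻ g, f (p, g) ∂gammaMeasure N 1 with hφ₁_def
  have hφ₁ : Measurable φ₁ := hf.lintegral_prod_right'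
  set φ : Plane → ℝ≥0∞ := fun x => ∫⁻ m, φ₁ (x, m) ∂markLaw ν c₁ c₂ with hφ_def
  have hφ : Measurable φ := hφ₁.lintegral_prod_right'
  have hf_le : ∀ p, f p ≤ 1 := fun p => expNeg_le_one _
  have hφ₁_le : ∀ p, φ₁ p ≤ 1 := fun p =>
    (lintegral_mono (g := fun _ => 1) fun g => hf_le _).trans (by simp)
  have hφ_le : ∀ x, φ x ≤ 1 := fun x =>
    (lintegral_mono (g := fun _ => 1) fun m => hφ₁_le _).trans (by simp)
  have hXm := hnet.projections.measurable
  -- The marks are averaged in two rounds: first the gains, independent of everything else, then the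
  -- angle and line-of-sight pairs, independent of the projections. A function of the projections
  -- alone remains.
  have hfinite : ∀ n : ℕ, ∫⁻ w, ∏ i ∈ Finset.range n,
      expNeg (s * receivedPower α ℓ (X i w) (Θ i w, LoS i w) (G i w)) ∂μ =
      ∫⁻ w, ∏ i ∈ Finset.range n, expNeg (negLog (φ (X i w))) ∂μ := fun n => by
    simp_rw [expNeg_negLog (hφ_le _)]
    refine (lintegral_prod_iid_marks (V := G) (W := fun i w => (X i w, (Θ i w, LoS i w)))
      hnet.gain_measurable (fun i => (hXm i).prodMk (hnet.measurable_mark i)) hnet.gain_indep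
      hnet.gain_law hnet.gain_indep_rest hf (Finset.range n)).trans ?_
    exact lintegral_prod_iid_marks (V := fun i w => (Θ i w, LoS i w)) (W := X)
      hnet.measurable_mark hXm hnet.mark_indep (hnet.hasLaw_mark hc₂)
      hnet.mark_indep_projections hφ₁ (Finset.range n)
  have hpm : ∀ i, Measurable fun w =>
      receivedPower α ℓ (X i w) (Θ i w, LoS i w) (G i w) := fun i =>
    hrm.comp (((hXm i).prodMk (hnet.measurable_mark i)).prodMk (hnet.gain_measurable i))
  have hlim : ∀ a : ℕ → Ω → ℝ≥0∞, (∀ i, Measurable (a i)) →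
      Tendsto (fun n => ∫⁻ w, ∏ i ∈ Finset.range n, expNeg (a i w) ∂μ) atTop
        (𝓝 (∫⁻ w, expNeg (∑' i, a i w) ∂μ)) := fun a ha => by
    refine tendsto_lintegral_of_dominated_convergence (fun _ => 1) (fun n => ?_)
      (fun n => ae_of_all _ fun w => ?_) (by simp)
      (ae_of_all _ fun w => tendsto_prod_expNeg fun i => a i w)
    · exact Finset.measurable_prod _ fun i _ => measurable_expNeg.comp (ha i)
    · exact Finset.prod_le_one' fun i _ => expNeg_le_one _
  have h1 := hlim (fun i w => s * receivedPower α ℓ (X i w) (Θ i w, LoS i w) (G i w))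
    fun i => (hpm i).const_mul s
  have h2 := hlim (fun i w => negLog (φ (X i w)))
    fun i => measurable_negLog.comp (hφ.comp (hXm i))
  have hE := tendsto_nhds_unique (h1.congr hfinite) h2
  simp_rw [ENNReal.tsum_mul_left] at hE
  refine hE.trans ?_
  rw [hnet.projections.laplaceFunctional (u := fun x => negLog (φ x)) (by fun_prop), lintegral_smul_measure]
  simp_rw [expNeg_negLog (hφ_le _), smul_eq_mul]
  congr 2
  -- The mark laws have total mass one, so `1 - ·` commutes with averaging; Tonelli then brings the
  -- integral over the plane innermost.
  have hsub : ∀ x, 1 - φ x =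
      ∫⁻ m, ∫⁻ g, (1 - f ((x, m), g)) ∂gammaMeasure N 1 ∂markLaw ν c₁ c₂ := fun x => by
    have hinner : ∀ m, ∫⁻ g, (1 - f ((x, m), g)) ∂gammaMeasure N 1 = 1 - φ₁ (x, m) := fun m => by
      rw [lintegral_sub (by fun_prop) ((hφ₁_le (x, m)).trans_lt (by simp)).ne
        (ae_of_all _ fun g => hf_le _)]
      simp [hφ₁_def]
    simp_rw [hinner]
    rw [lintegral_sub (by fun_prop) ((hφ_le x).trans_lt (by simp)).ne
      (ae_of_all _ fun m => hφ₁_le _)]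
    simp [hφ_def]
  simp_rw [hsub]
  rw [lintegral_lintegral_swap]
  · refine lintegral_congr fun m => ?_
    rw [lintegral_lintegral_swap]
    exact (Measurable.aemeasurable (by fun_prop))
  · exact ((measurable_const.sub hf).lintegral_prod_right').aemeasurable

end Network
-- Planar path-loss integrals and gamma moments
lemma volume_lt_mul_norm_rpow {α c r : ℝ} (hα : 0 < α) (hc : 0 < c) (hr : 0 < r) :
    volume {x : Plane | r < c * ‖x‖ ^ (-α)} =
      ENNReal.ofReal (Real.pi * c ^ (2 / α) * r ^ (-(2 / α))) := by
  -- The disc is punctured because `0 ^ (-α)` evaluates to `0` for real powers; the missing point is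
  -- null.
  have hset : {x : Plane | r < c * ‖x‖ ^ (-α)} = Metric.ball 0 ((c / r) ^ α⁻¹) \ {0} := by
    ext x
    simp only [Set.mem_ofPred_eq, Set.mem_sdiff, Metric.mem_ball, dist_zero_right,
      Set.mem_singleton_iff]
    rcases eq_or_ne x 0 with rfl | hx
    · simp [Real.zero_rpow (neg_ne_zero.2 hα.ne'), hr.le]
    · have hn : 0 < ‖x‖ := norm_pos_iff.2 hx
      rw [Real.lt_rpow_inv_iff_of_pos hn.le (by positivity) hα, Real.rpow_neg hn.le,
        lt_div_iff₀ hr, ← div_eq_mul_inv, lt_div_iff₀ (by positivity), mul_comm]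
      simp [hx]
  rw [hset, measure_sdiff_null (measure_singleton 0), EuclideanSpace.volume_ball_fin_two,
    ← ENNReal.ofReal_pow (by positivity), ← Real.rpow_natCast, ← Real.rpow_mul (by positivity),
    ← ENNReal.ofReal_mul (by positivity), Real.div_rpow hc.le hr.le,
    Real.rpow_neg hr.le]
  congr 1
  rw [show α⁻¹ * ((2 : ℕ) : ℝ) = 2 / α by push_cast; ring]
  ring

lemma lintegral_gamma_kernel {a C : ℝ} (ha : 0 < a) (hC : 0 ≤ C) :
    ∫⁻ r in Set.Ioi (0 : ℝ), ENNReal.ofReal (C * (Real.exp (-r) * r ^ (a - 1))) =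
      ENNReal.ofReal (C * Real.Gamma a) := by
  rw [Real.Gamma_eq_integral ha, ← integral_const_mul, ofReal_integral_eq_lintegral_ofReal]
  · exact (Real.GammaIntegral_convergent ha).const_mul C
  · filter_upwards [ae_restrict_mem measurableSet_Ioi] with r hr
    have : (0 : ℝ) < r := hr
    simp only [Pi.zero_apply]
    positivity

/-- Layer-cake formula: `1 - e^{-u} = ∫₀ᵘ e^{-t} dt`, and the path loss exceeds `t` on a disc of
area `π c^δ t^{-δ}` with `δ = 2/α`. What is left is `∫ e^{-t} t^{-δ} dt = Γ(1 - δ)`, finite because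
`α > 2`. -/
lemma lintegral_one_sub_expNeg_mul_norm_rpow {α c : ℝ} (hα : 2 < α) (hc : 0 ≤ c) :
    ∫⁻ x : Plane, (1 - expNeg (ENNReal.ofReal (c * ‖x‖ ^ (-α)))) =
      ENNReal.ofReal (Real.pi * c ^ (2 / α) * Real.Gamma (1 - 2 / α)) := by
  have hδ : 2 / α < 1 := (div_lt_one (by linarith)).2 hα
  have hδ' : 2 / α ≠ 0 := by positivity
  rcases hc.eq_or_lt with rfl | hc
  · simp [Real.zero_rpow hδ']
  have hint : ∀ x : Plane, 1 - expNeg (ENNReal.ofReal (c * ‖x‖ ^ (-α))) =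
      ENNReal.ofReal (∫ t in (0 : ℝ)..(c * ‖x‖ ^ (-α)), Real.exp (-t)) := fun x => by
    rw [expNeg_ofReal (by positivity), ← ENNReal.ofReal_one,
      ← ENNReal.ofReal_sub _ (by positivity)]
    congr 1
    rw [intervalIntegral.integral_comp_neg fun t => Real.exp t, integral_exp]
    simp
  simp_rw [hint]
  rw [lintegral_comp_eq_lintegral_meas_lt_mul]
  · rw [← lintegral_gamma_kernel (by linarith) (by positivity)]
    refine setLIntegral_congr_fun measurableSet_Ioi fun r hr => ?_
    have hr0 : (0 : ℝ) < r := hr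
    rw [volume_lt_mul_norm_rpow (by linarith) hc hr, ← ENNReal.ofReal_mul (by positivity)]
    congr 1
    rw [show 1 - 2 / α - 1 = -(2 / α) by ring]
    ring
  · exact ae_of_all _ fun x => by simp only [Pi.zero_apply]; positivity
  · exact (by fun_prop : Measurable fun x : Plane => c * ‖x‖ ^ (-α)).aemeasurable
  · exact fun t _ => (by fun_prop : Continuous fun t : ℝ => Real.exp (-t)).intervalIntegrable _ _
  · exact ae_of_all _ fun t => (Real.exp_pos _).le

/-- The factor `g^δ` shifts the shape parameter of the gamma density from `a` to `a + δ`. Values of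
`F` at `g ≤ 0` do not matter: the density vanishes for `g < 0` and `{0}` is null. -/
lemma lintegral_gammaMeasure_rpow {a δ C : ℝ} (ha : 0 < a) (hδ : 0 < δ) (hC : 0 ≤ C)
    {F : ℝ → ℝ≥0∞} (hFm : Measurable F)
    (hF : ∀ g, 0 < g → F g = ENNReal.ofReal (C * g ^ δ)) :
    ∫⁻ g, F g ∂gammaMeasure a 1 =
      ENNReal.ofReal (C * (Real.Gamma (a + δ) / Real.Gamma a)) := by
  have hΓ := Real.Gamma_pos_of_pos ha
  have hpdf : Measurable (gammaPDF a 1) := (measurable_gammaPDFReal a 1).ennreal_ofReal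
  rw [gammaMeasure, lintegral_withDensity_eq_lintegral_mul _ hpdf hFm,
    ← lintegral_add_compl _ (measurableSet_Ioi (a := (0 : ℝ))), Set.compl_Ioi]
  have h0 : ∫⁻ g in Set.Iic (0 : ℝ), (gammaPDF a 1 * F) g = 0 := by
    rw [setLIntegral_congr Iio_ae_eq_Iic.symm]
    refine (setLIntegral_congr_fun measurableSet_Iio fun g hg => ?_).trans (lintegral_zero)
    simp [gammaPDF_of_neg (show g < 0 from hg)]
  rw [h0, add_zero, show C * (Real.Gamma (a + δ) / Real.Gamma a) =
    C / Real.Gamma a * Real.Gamma (a + δ) by ring,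
    ← lintegral_gamma_kernel (by linarith) (by positivity)]
  refine setLIntegral_congr_fun measurableSet_Ioi fun g hg => ?_
  have hg0 : (0 : ℝ) < g := hg
  simp only [Pi.mul_apply]
  rw [hF g hg, gammaPDF_of_nonneg hg0.le, ← ENNReal.ofReal_mul (by positivity)]
  congr 1
  rw [show a + δ - 1 = (a - 1) + δ by ring, Real.rpow_add hg0]
  simp
  ring

/-! ### The signal is one-sided stable -/

section Network

variable {Ω : Type*} [MeasurableSpace Ω] {μ : Measure Ω} {X : ℕ → Ω → Plane}
  {Θ : ℕ → Ω → ℝ} {LoS : ℕ → Ω → Bool} {G : ℕ → Ω → ℝ} {ν : Measure ℝ} {lam c₁ c₂ : ℝ} {N : ℕ}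

lemma channelFactor_nonneg {ℓ : ℝ} (hℓ : 0 ≤ ℓ) (b : Bool) : 0 ≤ channelFactor ℓ b := by
  unfold channelFactor; split_ifs <;> linarith

/-- All factors but `‖x‖^{-α}` are collected into one constant; raising it to the power `2/α` turns
`cos^α θ` into `cos² θ`. -/
lemma lintegral_one_sub_expNeg_receivedPower {α ℓ s g θ : ℝ} (hα : 2 < α) (hℓ : 0 ≤ ℓ) (hs : 0 < s)
    (hg : 0 ≤ g) (hθ : θ ∈ Set.Ico 0 (Real.pi / 2)) (b : Bool) :
    ∫⁻ x : Plane, (1 - expNeg (ENNReal.ofReal s * receivedPower α ℓ x (θ, b) g)) =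
      ENNReal.ofReal (Real.pi * s ^ (2 / α) * Real.Gamma (1 - 2 / α) *
        (Real.cos θ ^ 2 * channelFactor ℓ b ^ (2 / α)) * g ^ (2 / α)) := by
  have hcos : 0 < Real.cos θ :=
    Real.cos_pos_of_mem_Ioo ⟨by linarith [hθ.1, Real.pi_pos], hθ.2⟩
  have hL := channelFactor_nonneg hℓ b
  have hpow : ∀ x : Plane, ENNReal.ofReal s * receivedPower α ℓ x (θ, b) g =
      ENNReal.ofReal (s * g * channelFactor ℓ b * Real.cos θ ^ α * ‖x‖ ^ (-α)) := fun x => by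
    rw [receivedPower, norm_position x hcos, ← ENNReal.ofReal_mul hs.le,
      Real.div_rpow (norm_nonneg _) hcos.le, Real.rpow_neg hcos.le, div_inv_eq_mul]
    congr 1
    ring
  simp_rw [hpow]
  rw [lintegral_one_sub_expNeg_mul_norm_rpow hα (by positivity), Real.mul_rpow (by positivity)
    (by positivity), Real.mul_rpow (by positivity) hL, Real.mul_rpow hs.le hg,
    ← Real.rpow_mul hcos.le, mul_div_cancel₀ _ (by linarith : α ≠ 0), Real.rpow_two]
  congr 1
  ring

lemma integrable_omega [IsProbabilityMeasure ν] (hc₂ : 0 < c₂) {ℓ α : ℝ} (hα : 0 < α)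
    (hℓ : ℓ ∈ Set.Icc (0 : ℝ) 1) :
    Integrable (fun θ => Real.cos θ ^ 2 *
      (losProb c₁ c₂ θ * (1 - ℓ ^ (2 / α)) + ℓ ^ (2 / α))) ν := by
  refine Integrable.of_bound (by fun_prop) 1 (ae_of_all _ fun θ => ?_)
  have h1 := losProb_pos hc₂ c₁ θ
  have h2 := losProb_le_one hc₂ c₁ θ
  have h3 : 0 ≤ ℓ ^ (2 / α) := Real.rpow_nonneg hℓ.1 _
  have h4 : ℓ ^ (2 / α) ≤ 1 := Real.rpow_le_one hℓ.1 hℓ.2 (by positivity)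
  have h5 : 0 ≤ losProb c₁ c₂ θ * (1 - ℓ ^ (2 / α)) := mul_nonneg h1.le (by linarith)
  have h6 : losProb c₁ c₂ θ * (1 - ℓ ^ (2 / α)) ≤ 1 - ℓ ^ (2 / α) :=
    mul_le_of_le_one_left (by linarith) h2
  rw [Real.norm_eq_abs, abs_of_nonneg (by positivity)]
  exact mul_le_one₀ (Real.cos_sq_le_one θ) (by linarith) (by linarith)

lemma omega_integrand_pos (hc₂ : 0 < c₂) {ℓ α : ℝ} (hα : 0 < α) (hℓ : ℓ ∈ Set.Icc (0 : ℝ) 1)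
    {θ : ℝ} (hθ : θ ∈ Set.Ico 0 (Real.pi / 2)) :
    0 < Real.cos θ ^ 2 * (losProb c₁ c₂ θ * (1 - ℓ ^ (2 / α)) + ℓ ^ (2 / α)) := by
  have hcos : 0 < Real.cos θ :=
    Real.cos_pos_of_mem_Ioo ⟨by linarith [hθ.1, Real.pi_pos], hθ.2⟩
  have h1 := losProb_pos hc₂ c₁ θ
  have h2 := losProb_le_one hc₂ c₁ θ
  have h3 : 0 ≤ ℓ ^ (2 / α) := Real.rpow_nonneg hℓ.1 _
  have h4 : ℓ ^ (2 / α) ≤ 1 := Real.rpow_le_one hℓ.1 hℓ.2 (by positivity)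
  refine mul_pos (by positivity) ?_
  nlinarith [mul_nonneg h3 (sub_nonneg.2 h2)]

/-- Strict positivity makes the stable scale positive, without which the transform would not decay
on vertical lines. It holds even for `ℓ = 0`, since `ρ > 0` and `cos θ > 0` on `[0, π/2)`. -/
lemma omega_pos [IsProbabilityMeasure ν] (hc₂ : 0 < c₂) {ℓ α : ℝ} (hα : 0 < α)
    (hℓ : ℓ ∈ Set.Icc (0 : ℝ) 1) (hν : ∀ᵐ θ ∂ν, θ ∈ Set.Ico 0 (Real.pi / 2)) :
    0 < omega ν c₁ c₂ α ℓ := by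
  have hpos := hν.mono fun θ hθ => omega_integrand_pos (c₁ := c₁) hc₂ hα hℓ hθ
  rw [omega, integral_pos_iff_support_of_nonneg_ae (hpos.mono fun θ h => h.le)
    (integrable_omega hc₂ hα hℓ)]
  refine pos_of_ne_zero fun h => ?_
  have h0 : ∀ᵐ θ ∂ν, False := by
    filter_upwards [hpos, measure_eq_zero_iff_ae_notMem.1 h] with θ h1 h2
    exact h2 h1.ne'
  exact IsProbabilityMeasure.ne_zero ν (by simpa using h0)

/-- The scale parameter of the stable law of the received signal. -/
noncomputable def signalScale (ν : Measure ℝ) (lam c₁ c₂ α ℓ : ℝ) (N : ℕ) : ℝ :=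
  Real.pi * lam * omega ν c₁ c₂ α ℓ / (N - 1).factorial *
    Real.Gamma (N + 2 / α) * Real.Gamma (1 - 2 / α)

lemma signalScale_pos [IsProbabilityMeasure ν] (hlam : 0 < lam) (hc₂ : 0 < c₂) {ℓ α : ℝ}
    (hα : 2 < α) (hℓ : ℓ ∈ Set.Icc (0 : ℝ) 1) (hν : ∀ᵐ θ ∂ν, θ ∈ Set.Ico 0 (Real.pi / 2)) :
    0 < signalScale ν lam c₁ c₂ α ℓ N := by
  have hω := omega_pos (c₁ := c₁) hc₂ (by linarith : 0 < α) hℓ hν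
  have h1 : 0 < Real.Gamma (N + 2 / α) := Real.Gamma_pos_of_pos (by positivity)
  have h2 : 0 < Real.Gamma (1 - 2 / α) :=
    Real.Gamma_pos_of_pos (sub_pos.2 ((div_lt_one (by linarith)).2 hα))
  have h3 := Real.pi_pos
  unfold signalScale
  positivity

lemma measurable_lintegral_one_sub_expNeg_receivedPower {T : Type*} [MeasurableSpace T]
    (α ℓ s : ℝ) {m : T → ℝ × Bool} {g : T → ℝ} (hm : Measurable m) (hg : Measurable g) :
    Measurable fun t => ∫⁻ x : Plane,
      (1 - expNeg (ENNReal.ofReal s * receivedPower α ℓ x (m t) (g t))) := by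
  have hr : Measurable fun p : T × Plane => receivedPower α ℓ p.2 (m p.1) (g p.1) :=
    (measurable_receivedPower α ℓ).comp
      (g := fun p : (Plane × (ℝ × Bool)) × ℝ => receivedPower α ℓ p.1.1 p.1.2 p.2)
      (f := fun p : T × Plane => ((p.2, m p.1), g p.1)) (by fun_prop)
  have hf : Measurable fun p : T × Plane =>
      1 - expNeg (ENNReal.ofReal s * receivedPower α ℓ p.2 (m p.1) (g p.1)) := by fun_prop
  exact hf.lintegral_prod_right'

lemma lintegral_gain_one_sub_expNeg_receivedPower {α ℓ s θ a : ℝ} (hα : 2 < α) (hℓ : 0 ≤ ℓ)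
    (hs : 0 < s) (ha : 0 < a) (hθ : θ ∈ Set.Ico 0 (Real.pi / 2)) (b : Bool) :
    ∫⁻ g, (∫⁻ x : Plane, (1 - expNeg (ENNReal.ofReal s * receivedPower α ℓ x (θ, b) g)))
        ∂gammaMeasure a 1 =
      ENNReal.ofReal (Real.pi * s ^ (2 / α) * Real.Gamma (1 - 2 / α) *
        (Real.cos θ ^ 2 * channelFactor ℓ b ^ (2 / α)) *
        (Real.Gamma (a + 2 / α) / Real.Gamma a)) := by
  have hΓ : 0 < Real.Gamma (1 - 2 / α) :=
    Real.Gamma_pos_of_pos (sub_pos.2 ((div_lt_one (by linarith)).2 hα))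
  have hL := channelFactor_nonneg hℓ b
  have hπ := Real.pi_pos
  have hC : 0 ≤ Real.pi * s ^ (2 / α) * Real.Gamma (1 - 2 / α) *
      (Real.cos θ ^ 2 * channelFactor ℓ b ^ (2 / α)) := by positivity
  have hδ : 0 < 2 / α := by positivity
  have hm : Measurable fun g => ∫⁻ x : Plane,
      (1 - expNeg (ENNReal.ofReal s * receivedPower α ℓ x (θ, b) g)) :=
    measurable_lintegral_one_sub_expNeg_receivedPower α ℓ s measurable_const measurable_id
  have hF : ∀ g, 0 < g → ∫⁻ x : Plane,
      (1 - expNeg (ENNReal.ofReal s * receivedPower α ℓ x (θ, b) g)) =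
      ENNReal.ofReal (Real.pi * s ^ (2 / α) * Real.Gamma (1 - 2 / α) *
        (Real.cos θ ^ 2 * channelFactor ℓ b ^ (2 / α)) * g ^ (2 / α)) :=
    fun g hg => lintegral_one_sub_expNeg_receivedPower hα hℓ hs hg.le hθ b
  exact lintegral_gammaMeasure_rpow ha hδ hC hm hF

/-- Averaging `L^δ` over the line-of-sight indicator gives `ρ + (1 - ρ) ℓ^δ = ρ (1 - ℓ^δ) + ℓ^δ`,
the bracket in `omega`. -/
lemma lintegral_losProb_mul_eq_omega [IsProbabilityMeasure ν] (hc₂ : 0 < c₂) {α ℓ A B : ℝ}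
    (hα : 0 < α) (hℓ : ℓ ∈ Set.Icc (0 : ℝ) 1) (hA : 0 ≤ A) (hB : 0 ≤ B)
    (hν : ∀ᵐ θ ∂ν, θ ∈ Set.Ico 0 (Real.pi / 2)) :
    ∫⁻ θ, (ENNReal.ofReal (losProb c₁ c₂ θ) *
        ENNReal.ofReal (A * (Real.cos θ ^ 2 * channelFactor ℓ true ^ (2 / α)) * B) +
      ENNReal.ofReal (1 - losProb c₁ c₂ θ) *
        ENNReal.ofReal (A * (Real.cos θ ^ 2 * channelFactor ℓ false ^ (2 / α)) * B)) ∂ν =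
      ENNReal.ofReal (A * B * omega ν c₁ c₂ α ℓ) := by
  rw [omega, ← integral_const_mul, ofReal_integral_eq_lintegral_ofReal
    ((integrable_omega hc₂ hα hℓ).const_mul _)]
  · refine lintegral_congr fun θ => ?_
    have h1 := losProb_pos hc₂ c₁ θ
    have h2 := losProb_le_one hc₂ c₁ θ
    have h3 := channelFactor_nonneg hℓ.1 true
    have h4 := channelFactor_nonneg hℓ.1 false
    have h5 : 0 ≤ 1 - losProb c₁ c₂ θ := by linarith
    rw [← ENNReal.ofReal_mul h1.le, ← ENNReal.ofReal_mul h5,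
      ← ENNReal.ofReal_add (by positivity) (by positivity)]
    congr 1
    simp only [channelFactor, if_true, Bool.false_eq_true, if_false, Real.one_rpow]
    ring
  · filter_upwards [hν] with θ hθ
    have := omega_integrand_pos (c₁ := c₁) hc₂ hα hℓ hθ
    simp only [Pi.zero_apply]
    positivity

/-- The Laplace transform of the received signal is that of a one-sided stable law. -/
theorem IsAPILNetwork.lintegral_expNeg_shotSignal [IsProbabilityMeasure μ]
    (hnet : IsAPILNetwork μ X Θ LoS G ν lam c₁ c₂ N) (hlam : 0 < lam) (hc₂ : 0 < c₂)
    (hN : 1 ≤ N) {α ℓ s : ℝ} (hα : 2 < α) (hℓ : ℓ ∈ Set.Icc (0 : ℝ) 1) (hs : 0 < s) :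
    ∫⁻ w, expNeg (ENNReal.ofReal s * shotSignal X Θ LoS G α ℓ w) ∂μ =
      ENNReal.ofReal (Real.exp (-(signalScale ν lam c₁ c₂ α ℓ N * s ^ (2 / α)))) := by
  have hprob : IsProbabilityMeasure ν :=
    (hnet.angle_law 0).isProbabilityMeasure_iff.1 inferInstance
  have hN0 : (0 : ℝ) < N := by exact_mod_cast hN
  have hsf : SFinite (gammaMeasure N 1) :=
    have := isProbabilityMeasure_gammaMeasure hN0 one_pos
    inferInstance
  have hK := signalScale_pos (N := N) (c₁ := c₁) hlam hc₂ hα hℓ hnet.angle_mem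
  rw [hnet.lintegral_expNeg_mul_shotSignal hc₂ hN, ← expNeg_ofReal (by positivity)]
  congr 1
  have hΓ : 0 < Real.Gamma (1 - 2 / α) :=
    Real.Gamma_pos_of_pos (sub_pos.2 ((div_lt_one (by linarith)).2 hα))
  have hΓ' : 0 < Real.Gamma (N + 2 / α) := Real.Gamma_pos_of_pos (by positivity)
  have hΓN : 0 < Real.Gamma N := Real.Gamma_pos_of_pos hN0
  have hπ := Real.pi_pos
  have hmean : ∫⁻ m, ∫⁻ g, (∫⁻ x : Plane,
      (1 - expNeg (ENNReal.ofReal s * receivedPower α ℓ x m g))) ∂gammaMeasure N 1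
        ∂markLaw ν c₁ c₂ =
      ENNReal.ofReal (Real.pi * s ^ (2 / α) * Real.Gamma (1 - 2 / α) *
        (Real.Gamma (N + 2 / α) / Real.Gamma N) * omega ν c₁ c₂ α ℓ) := by
    rw [lintegral_markLaw ν c₁ c₂
        (measurable_lintegral_one_sub_expNeg_receivedPower α ℓ s measurable_fst measurable_snd).lintegral_prod_right',
      ← lintegral_losProb_mul_eq_omega hc₂ (by linarith) hℓ (by positivity) (by positivity)
        hnet.angle_mem]
    refine lintegral_congr_ae ?_
    filter_upwards [hnet.angle_mem] with θ hθ
    rw [lintegral_gain_one_sub_expNeg_receivedPower hα hℓ.1 hs hN0 hθ true,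
      lintegral_gain_one_sub_expNeg_receivedPower hα hℓ.1 hs hN0 hθ false]
  rw [hmean, ← ENNReal.ofReal_mul hlam.le, signalScale]
  congr 1
  obtain ⟨n, rfl⟩ : ∃ n, N = n + 1 := ⟨N - 1, by omega⟩
  rw [Nat.cast_add_one, Real.Gamma_nat_eq_factorial, Nat.add_sub_cancel]
  field_simp

end Network
-- Inversion of the Laplace transform
open scoped FourierTransform

/-- The Laplace transform of the distribution function of the one-sided stable law. -/
noncomputable def stableTransform (K δ : ℝ) (s : ℂ) : ℂ :=
  1 / s * Complex.exp (-((K : ℂ) * s ^ (δ : ℂ)))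

lemma differentiableAt_exp_neg_mul_cpow (K δ : ℝ) {z : ℂ} (hz : 0 < z.re) :
    DifferentiableAt ℂ (fun s : ℂ => Complex.exp (-((K : ℂ) * s ^ (δ : ℂ)))) z := by
  have h : DifferentiableAt ℂ (fun s : ℂ => s ^ (δ : ℂ)) z :=
    differentiableAt_id.cpow_const (Or.inl hz)
  exact ((h.const_mul _).neg).cexp

lemma differentiableAt_stableTransform (K δ : ℝ) {z : ℂ} (hz : 0 < z.re) :
    DifferentiableAt ℂ (stableTransform K δ) z := by
  have h0 : z ≠ 0 := by rintro rfl; simp at hz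
  exact (((differentiableAt_const 1).div differentiableAt_id h0)).mul
    (differentiableAt_exp_neg_mul_cpow K δ hz)

section Transform

variable {Ω : Type*} [MeasurableSpace Ω] {μ : Measure Ω} [IsProbabilityMeasure μ] {Y : Ω → ℝ}
  {K δ : ℝ}

/-- The real Laplace transform of a stable variable extends to the right half-plane. -/
lemma integral_cexp_neg_mul_eq_of_real (hY : Measurable Y) (h0 : ∀ᵐ w ∂μ, 0 ≤ Y w)
    (h : ∀ s : ℝ, 0 < s → ∫ w, Real.exp (-(s * Y w)) ∂μ = Real.exp (-(K * s ^ δ)))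
    {z : ℂ} (hz : 0 < z.re) :
    ∫ w, Complex.exp (-(z * Y w)) ∂μ = Complex.exp (-((K : ℂ) * z ^ (δ : ℂ))) := by
  -- For `Y ≥ 0` the variable `-Y` has exponential moments of every positive order, so its complex
  -- moment generating function is analytic on the right half-plane.
  have hsub : Set.Ioi (0 : ℝ) ⊆ interior (integrableExpSet (fun w => -Y w) μ) := by
    refine interior_maximal (fun s hs => ?_) isOpen_Ioi
    have hs' : (0 : ℝ) < s := hs
    refine Integrable.of_bound (by fun_prop) 1 ?_
    filter_upwards [h0] with w hw
    rw [Real.norm_eq_abs, Real.abs_exp, Real.exp_le_one_iff]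
    nlinarith
  have hA : AnalyticOnNhd ℂ (complexMGF (fun w => -Y w) μ) {z | 0 < z.re} := fun z hz =>
    analyticAt_complexMGF (hsub hz)
  have hopen : IsOpen {z : ℂ | 0 < z.re} := isOpen_lt continuous_const Complex.continuous_re
  have hB : AnalyticOnNhd ℂ (fun s : ℂ => Complex.exp (-((K : ℂ) * s ^ (δ : ℂ))))
      {z | 0 < z.re} :=
    DifferentiableOn.analyticOnNhd
      (fun z hz => (differentiableAt_exp_neg_mul_cpow K δ hz).differentiableWithinAt) hopen
  have hreal : ∀ s : ℝ, 0 < s → complexMGF (fun w => -Y w) μ s =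
      Complex.exp (-((K : ℂ) * (s : ℂ) ^ (δ : ℂ))) := fun s hs => by
    rw [complexMGF_ofReal, mgf]
    simp_rw [mul_neg]
    rw [h s hs, ← Complex.ofReal_cpow hs.le]
    push_cast
    rfl
  have hpre : IsPreconnected {z : ℂ | 0 < z.re} := (convex_halfSpace_re_gt 0).isPreconnected
  -- The identity theorem only needs agreement at points accumulating at `1`; the real ones near `1`
  -- suffice.
  have hfreq : ∃ᶠ z : ℂ in 𝓝[≠] ((1 : ℝ) : ℂ), complexMGF (fun w => -Y w) μ z =
      Complex.exp (-((K : ℂ) * z ^ (δ : ℂ))) := by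
    have ht : Tendsto (fun x : ℝ => (x : ℂ)) (𝓝[≠] 1) (𝓝[≠] ((1 : ℝ) : ℂ)) := by
      refine tendsto_nhdsWithin_of_tendsto_nhds_of_eventually_within _
        (Complex.continuous_ofReal.continuousAt.tendsto.mono_left nhdsWithin_le_nhds) ?_
      filter_upwards [self_mem_nhdsWithin] with x hx
      exact fun h => hx (Complex.ofReal_injective h)
    refine ht.frequently (Eventually.frequently ?_)
    filter_upwards [nhdsWithin_le_nhds (Ioi_mem_nhds one_pos)] with x hx using hreal x hx
  have := hA.eqOn_of_preconnected_of_frequently_eq hB hpre (by simp) hfreq hz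
  simp only [complexMGF] at this
  rw [← this]
  refine integral_congr_ae (ae_of_all _ fun w => ?_)
  push_cast
  simp

/-- The Laplace transform of a distribution function. -/
lemma integral_cexp_mul_measure_lt (hY : Measurable Y) (h0 : ∀ᵐ w ∂μ, 0 ≤ Y w)
    {s : ℂ} (hs : 0 < s.re) :
    ∫ t in Set.Ioi (0 : ℝ), Complex.exp (-s * t) * (μ.real {w | Y w < t} : ℂ) =
      1 / s * ∫ w, Complex.exp (-(s * Y w)) ∂μ := by
  have hs' : (-s).re < 0 := by simpa using hs
  have hint := integrableOn_exp_mul_complex_Ioi hs' 0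
  have hset : MeasurableSet {p : ℝ × Ω | Y p.2 < p.1} :=
    measurableSet_lt (by fun_prop) (by fun_prop)
  -- Fubini on `{Y < t}`: integrating out `ω` gives `P(Y < t)`, integrating out `t` gives `e^{-sY} /
  -- s`. The dominating function `e^{-st}` is integrable as `Re s > 0`.
  have hprod : Integrable (fun p : ℝ × Ω =>
      {p : ℝ × Ω | Y p.2 < p.1}.indicator (fun p => Complex.exp (-s * p.1)) p)
      ((volume.restrict (Set.Ioi 0)).prod μ) := by
    refine Integrable.indicator ?_ hset
    exact Integrable.comp_fst (f := fun t : ℝ => Complex.exp (-s * t)) hint μ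
  have hleft : ∀ t : ℝ, Complex.exp (-s * t) * (μ.real {w | Y w < t} : ℂ) =
      ∫ w, {p : ℝ × Ω | Y p.2 < p.1}.indicator (fun p => Complex.exp (-s * p.1)) (t, w) ∂μ := by
    intro t
    have : (fun w => {p : ℝ × Ω | Y p.2 < p.1}.indicator
        (fun p => Complex.exp (-s * p.1)) (t, w)) =
        {w | Y w < t}.indicator fun _ => Complex.exp (-s * t) := by
      funext w; simp [Set.indicator]
    rw [this, integral_indicator (measurableSet_lt hY measurable_const), setIntegral_const,
      Complex.real_smul, mul_comm]
  simp_rw [hleft]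
  rw [integral_integral_swap hprod, ← integral_const_mul]
  refine integral_congr_ae ?_
  filter_upwards [h0] with w hw
  have : (fun t : ℝ => {p : ℝ × Ω | Y p.2 < p.1}.indicator
      (fun p => Complex.exp (-s * p.1)) (t, w)) =
      (Set.Ioi (Y w)).indicator fun t : ℝ => Complex.exp (-s * t) := by
    funext t; simp [Set.indicator]
  rw [this, setIntegral_indicator measurableSet_Ioi,
    Set.inter_eq_right.2 (Set.Ioi_subset_Ioi hw), integral_exp_mul_complex_Ioi hs']
  rw [neg_div_neg_eq, neg_mul]
  ring

end Transform

/-- On the right half-plane `|arg s| ≤ π/2`, so `|δ arg s| ≤ πδ/2 < π/2`. The cosine on the left is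
thus positive, and this bound is the source of the decay of `exp (-K s^δ)`. -/
lemma re_mul_cos_le_re_cpow {δ : ℝ} (hδ : δ ∈ Set.Ioo (0 : ℝ) 1) {s : ℂ} (hs : 0 < s.re) :
    ‖s‖ ^ δ * Real.cos (Real.pi / 2 * δ) ≤ (s ^ (δ : ℂ)).re := by
  rw [Complex.cpow_ofReal_re]
  refine mul_le_mul_of_nonneg_left ?_ (by positivity)
  rw [← Real.cos_abs (s.arg * δ), abs_mul, abs_of_pos hδ.1]
  have h1 := Complex.abs_arg_le_pi_div_two_iff.2 hs.le
  refine Real.cos_le_cos_of_nonneg_of_le_pi (mul_nonneg (abs_nonneg _) hδ.1.le) ?_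
    (mul_le_mul_of_nonneg_right h1 hδ.1.le)
  nlinarith [Real.pi_pos, hδ.2, hδ.1]

lemma integrable_exp_neg_mul_abs_rpow {δ k : ℝ} (hδ : 0 < δ) (hk : 0 < k) :
    Integrable fun y : ℝ => Real.exp (-k * |y| ^ δ) := by
  have h := integrableOn_rpow_mul_exp_neg_mul_rpow (s := 0) (by norm_num) hδ hk
  simp only [Real.rpow_zero, one_mul] at h
  have h' : IntegrableOn (fun y : ℝ => Real.exp (-k * |y| ^ δ)) (Set.Ioi 0) :=
    h.congr_fun (fun y hy => by simp only [abs_of_pos (show (0 : ℝ) < y from hy)])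
      measurableSet_Ioi
  have h'' := IntegrableOn.comp_neg_Iio (c := 0) (f := fun y : ℝ => Real.exp (-k * |y| ^ δ))
    (by simpa using h')
  simp only [abs_neg] at h''
  rw [← integrableOn_univ, ← Set.Iic_union_Ioi (a := (0 : ℝ))]
  exact ((integrableOn_Iic_iff_integrableOn_Iio (by simp)).2 h'').union h'

/-- The transform of a stable distribution function is integrable along vertical lines. -/
lemma integrable_stableTransform {K δ γ : ℝ} (hK : 0 < K) (hδ : δ ∈ Set.Ioo (0 : ℝ) 1)
    (hγ : 0 < γ) : Integrable fun y : ℝ => stableTransform K δ (γ + y * Complex.I) := by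
  have hre : ∀ y : ℝ, ((γ : ℂ) + y * Complex.I).re = γ := fun y => by simp
  have him : ∀ y : ℝ, ((γ : ℂ) + y * Complex.I).im = y := fun y => by simp
  have hcos : 0 < Real.cos (Real.pi / 2 * δ) :=
    Real.cos_pos_of_mem_Ioo ⟨by nlinarith [Real.pi_pos, hδ.1], by nlinarith [Real.pi_pos, hδ.2]⟩
  have hcont : Continuous fun y : ℝ => stableTransform K δ (γ + y * Complex.I) := by
    refine continuous_iff_continuousAt.2 fun y => ?_
    have h1 : ContinuousAt (stableTransform K δ) (γ + y * Complex.I) :=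
      (differentiableAt_stableTransform K δ (by rw [hre]; exact hγ)).continuousAt
    exact ContinuousAt.comp (f := fun y : ℝ => (γ : ℂ) + y * Complex.I) h1 (by fun_prop)
  refine ((integrable_exp_neg_mul_abs_rpow hδ.1 (mul_pos hK hcos)).const_mul γ⁻¹).mono'
    hcont.aestronglyMeasurable (ae_of_all _ fun y => ?_)
  rw [stableTransform, norm_mul, Complex.norm_exp, one_div, norm_inv]
  set s : ℂ := γ + y * Complex.I with hs_def
  have hγs : γ ≤ ‖s‖ := by
    have := Complex.abs_re_le_norm s
    rwa [hre, abs_of_pos hγ] at this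
  have hys : |y| ≤ ‖s‖ := by
    have := Complex.abs_im_le_norm s
    rwa [him] at this
  refine mul_le_mul (inv_anti₀ hγ hγs) (Real.exp_le_exp.2 ?_) (Real.exp_pos _).le (by positivity)
  have h1 := re_mul_cos_le_re_cpow hδ (s := s) (by rw [hre]; exact hγ)
  have h2 : |y| ^ δ ≤ ‖s‖ ^ δ := Real.rpow_le_rpow (abs_nonneg _) hys hδ.1.le
  rw [Complex.neg_re, Complex.re_ofReal_mul]
  have h3 : |y| ^ δ * Real.cos (Real.pi / 2 * δ) ≤ (s ^ (δ : ℂ)).re :=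
    (mul_le_mul_of_nonneg_right h2 hcos.le).trans h1
  nlinarith [mul_le_mul_of_nonneg_left h3 hK.le]

/-- A monotone function that agrees with a continuous one off a countable set agrees with it
on the whole open half-line. -/
lemma eq_of_monotone_of_continuous_of_countable {H c : ℝ → ℝ} (hH : Monotone H)
    (hc : Continuous c) {D : Set ℝ} (hD : D.Countable)
    (h : ∀ t, 0 < t → t ∉ D → H t = c t) {t : ℝ} (ht : 0 < t) : H t = c t := by
  have hdense : Dense Dᶜ := hD.dense_compl ℝ
  refine le_antisymm ?_ ?_
  · refine le_of_forall_pos_le_add fun ε hε => ?_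
    obtain ⟨η, hη, hη'⟩ := Metric.continuousAt_iff.1 hc.continuousAt ε hε
    obtain ⟨b, hb, hb'⟩ := hdense.exists_mem_open isOpen_Ioo
      (show (Set.Ioo t (t + η)).Nonempty from ⟨t + η / 2, by constructor <;> linarith⟩)
    have h1 := hη' (show dist b t < η by
      rw [Real.dist_eq, abs_lt]; constructor <;> linarith [hb'.1, hb'.2])
    rw [Real.dist_eq, abs_lt] at h1
    have h2 := h b (ht.trans hb'.1) hb
    linarith [hH hb'.1.le, h1.2]
  · refine le_of_forall_pos_le_add fun ε hε => ?_
    obtain ⟨η, hη, hη'⟩ := Metric.continuousAt_iff.1 hc.continuousAt ε hε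
    obtain ⟨b, hb, hb'⟩ := hdense.exists_mem_open isOpen_Ioo
      (show (Set.Ioo (max 0 (t - η)) t).Nonempty from Set.nonempty_Ioo.2
        (max_lt ht (by linarith)))
    have h0 : 0 < b := (le_max_left _ _).trans_lt hb'.1
    have h3 : t - η < b := (le_max_right _ _).trans_lt hb'.1
    have h1 := hη' (show dist b t < η by
      rw [Real.dist_eq, abs_lt]; constructor <;> linarith [hb'.2])
    rw [Real.dist_eq, abs_lt] at h1
    have h2 := h b h0 hb
    linarith [hH hb'.2.le, h1.1]

section Inversion

variable {Ω : Type*} [MeasurableSpace Ω] {μ : Measure Ω} [IsProbabilityMeasure μ] {Y : Ω → ℝ}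
  {K δ : ℝ}

/-- Inversion of the Laplace transform of a stable distribution function. -/
theorem bromwich_integral_stableTransform (hY : Measurable Y) (h0 : ∀ᵐ w ∂μ, 0 ≤ Y w)
    (hK : 0 < K) (hδ : δ ∈ Set.Ioo (0 : ℝ) 1)
    (h : ∀ s : ℝ, 0 < s → ∫ w, Real.exp (-(s * Y w)) ∂μ = Real.exp (-(K * s ^ δ)))
    {γ t : ℝ} (hγ : 0 < γ) (ht : 0 < t) :
    1 / (2 * (Real.pi : ℂ)) * ∫ y : ℝ, Complex.exp (((γ : ℂ) + y * Complex.I) * t) *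
      stableTransform K δ (γ + y * Complex.I) = (μ.real {w | Y w < t} : ℂ) := by
  set H : ℝ → ℝ := fun t => μ.real {w | Y w < t} with hH_def
  have hHmono : Monotone H := fun a b hab =>
    measureReal_mono fun w (hw : Y w < a) => hw.trans_le hab
  -- Damping by `e^{-γt}` makes the distribution function integrable, and its Fourier transform at
  -- `ξ` is the Laplace transform at `γ + 2πiξ`.
  set g : ℝ → ℂ := (Set.Ioi (0 : ℝ)).indicator fun t => Complex.exp (-(γ : ℂ) * t) * H t with hg_def
  have hg : Integrable g := by
    refine IntegrableOn.integrable_indicator ?_ measurableSet_Ioi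
    refine (integrableOn_exp_mul_complex_Ioi (a := -(γ : ℂ)) (by simpa using hγ) 0).mul_bdd
      (c := 1) ?_ (ae_of_all _ fun x => ?_)
    · exact (Complex.measurable_ofReal.comp hHmono.measurable).aestronglyMeasurable
    · rw [Complex.norm_real, Real.norm_of_nonneg measureReal_nonneg]
      exact measureReal_le_one
  have hFg : ∀ ξ : ℝ, 𝓕 g ξ = stableTransform K δ (γ + (2 * Real.pi * ξ : ℝ) * Complex.I) := by
    intro ξ
    set s : ℂ := γ + (2 * Real.pi * ξ : ℝ) * Complex.I with hs_def
    have hs : 0 < s.re := by simpa [hs_def] using hγ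
    rw [Real.fourier_real_eq_integral_exp_smul, stableTransform,
      ← integral_cexp_neg_mul_eq_of_real hY h0 h hs, ← integral_cexp_mul_measure_lt hY h0 hs,
      ← integral_indicator measurableSet_Ioi]
    refine integral_congr_ae (ae_of_all _ fun x => ?_)
    by_cases hx : x ∈ Set.Ioi (0 : ℝ)
    · simp only [hg_def, Set.indicator_of_mem hx, smul_eq_mul, ← mul_assoc, ← Complex.exp_add]
      congr 2
      rw [hs_def]; push_cast; ring
    · simp [hg_def, Set.indicator_of_notMem hx]
  have hFint : Integrable (𝓕 g) := by
    rw [funext hFg]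
    exact (integrable_stableTransform hK hδ hγ).comp_mul_left' (by positivity)
  have hinv : ∀ x : ℝ, 𝓕⁻ (𝓕 g) x = 1 / (2 * (Real.pi : ℂ)) *
      ∫ y : ℝ, Complex.exp (y * x * Complex.I) * stableTransform K δ (γ + y * Complex.I) := by
    intro x
    rw [Real.fourierInv_eq']
    simp_rw [hFg]
    have := Measure.integral_comp_mul_left (fun y : ℝ => Complex.exp (y * x * Complex.I) *
      stableTransform K δ (γ + y * Complex.I)) (2 * Real.pi)
    rw [abs_of_pos (by positivity), Complex.real_smul] at this
    push_cast at this
    rw [one_div, ← this]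
    refine integral_congr_ae (ae_of_all _ fun y => ?_)
    simp only [smul_eq_mul, RCLike.inner_apply, conj_trivial]
    push_cast
    congr 2
    ring
  have hcont : Continuous (𝓕⁻ (𝓕 g)) := by
    rw [show 𝓕⁻ (𝓕 g) = fun x => 𝓕 (𝓕 g) (-x) from
      funext fun x => Real.fourierInv_eq_fourier_neg _ _]
    exact (VectorFourier.fourierIntegral_continuous Real.continuous_fourierChar
      (by exact continuous_inner) hFint).comp continuous_neg
  set c : ℝ → ℂ := fun x => Complex.exp ((γ : ℂ) * x) * 𝓕⁻ (𝓕 g) x with hc_def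
  have hcc : Continuous c := by fun_prop
  -- Pointwise Fourier inversion is available only where `H` is continuous. A monotone `H` has
  -- countably many other points, and continuity of `c` then gives equality at every `t > 0`.
  have hcH : ∀ x : ℝ, 0 < x → x ∉ {x | ¬ContinuousAt H x} → (H x : ℂ) = c x := fun x hx hxD => by
    have hcH : ContinuousAt H x := by simpa using hxD
    have hgx : g =ᶠ[𝓝 x] fun t => Complex.exp (-(γ : ℂ) * t) * H t := by
      filter_upwards [Ioi_mem_nhds hx] with y hy
      simp only [hg_def, Set.indicator_of_mem (show y ∈ Set.Ioi (0 : ℝ) from hy)]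
    have hcg : ContinuousAt g x := by
      refine ContinuousAt.congr (ContinuousAt.mul (by fun_prop) ?_) hgx.symm
      exact Complex.continuous_ofReal.continuousAt.comp hcH
    simp only [hc_def]
    rw [hg.fourierInv_fourier_eq hFint hcg, hgx.self_of_nhds, ← mul_assoc, ← Complex.exp_add]
    simp
  have hre : H t = (c t).re :=
    eq_of_monotone_of_continuous_of_countable hHmono (c := fun x => (c x).re) (by fun_prop)
      hHmono.countable_not_continuousAt (fun x hx hxD => by simp [← hcH x hx hxD]) ht
  have him : 0 = (c t).im :=
    eq_of_monotone_of_continuous_of_countable (H := fun _ => 0) monotone_const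
      (c := fun x => (c x).im) (by fun_prop)
      hHmono.countable_not_continuousAt (fun x hx hxD => by simp [← hcH x hx hxD]) ht
  have hct : (H t : ℂ) = c t := Complex.ext (by simpa using hre) (by simpa using him)
  have hexp : ∀ y : ℝ, Complex.exp (((γ : ℂ) + y * Complex.I) * t) *
      stableTransform K δ (γ + y * Complex.I) = Complex.exp ((γ : ℂ) * t) *
      (Complex.exp (y * t * Complex.I) * stableTransform K δ (γ + y * Complex.I)) := fun y => by
    rw [← mul_assoc, ← Complex.exp_add]
    congr 2
    ring
  simp_rw [hexp]
  rw [integral_const_mul, hct, hc_def]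
  simp only [hinv]
  ring

/-- If the Laplace transform of `Y ≥ 0` is `exp (-K s^δ)`, then the value at `t` of the inverse
Laplace transform of `s⁻¹ exp (-K s^δ)` is `P(Y < t)`. -/
theorem hasInverseLaplaceAt_stableTransform (hY : Measurable Y) (h0 : ∀ᵐ w ∂μ, 0 ≤ Y w)
    (hK : 0 < K) (hδ : δ ∈ Set.Ioo (0 : ℝ) 1)
    (h : ∀ s : ℝ, 0 < s → ∫ w, Real.exp (-(s * Y w)) ∂μ = Real.exp (-(K * s ^ δ)))
    {t : ℝ} (ht : 0 < t) :
    HasInverseLaplaceAt (stableTransform K δ) 0 t (μ.real {w | Y w < t} : ℂ) := by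
  refine ⟨fun z hz => (differentiableAt_stableTransform K δ hz).differentiableWithinAt,
    fun γ hγ => ?_⟩
  rw [← bromwich_integral_stableTransform hY h0 hK hδ h hγ ht]
  -- The integrand is absolutely integrable on the line, so the truncated integrals tend to the full
  -- one.
  refine (intervalIntegral_tendsto_integral ?_ tendsto_neg_atTop_atBot tendsto_id).const_mul _
  refine (integrable_stableTransform hK hδ hγ).bdd_mul (c := Real.exp (γ * t)) ?_
    (ae_of_all _ fun y => ?_)
  · exact (by fun_prop : Continuous fun y : ℝ =>
      Complex.exp (((γ : ℂ) + y * Complex.I) * t)).aestronglyMeasurable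
  · rw [Complex.norm_exp]
    simp

end Inversion

/-! ### The error function and the stable law of index `1/2` -/

lemma integrable_exp_neg_sq : Integrable fun x : ℝ => Real.exp (-x ^ 2) := by
  simpa using integrable_exp_neg_mul_sq one_pos

lemma hasDerivAt_erf (x : ℝ) : HasDerivAt erf (2 / √Real.pi * Real.exp (-x ^ 2)) x := by
  have hc : Continuous fun t : ℝ => Real.exp (-t ^ 2) := by fun_prop
  exact (intervalIntegral.integral_hasDerivAt_right (hc.intervalIntegrable _ _)
    (hc.stronglyMeasurableAtFilter _ _) hc.continuousAt).const_mul _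

lemma integral_exp_neg_sq_Ioi : ∫ x in Set.Ioi (0 : ℝ), Real.exp (-x ^ 2) = √Real.pi / 2 := by
  simpa using integral_gaussian_Ioi 1

lemma tendsto_erf_atTop : Tendsto erf atTop (𝓝 1) := by
  have h := (intervalIntegral_tendsto_integral_Ioi 0 integrable_exp_neg_sq.integrableOn
    tendsto_id).const_mul (2 / √Real.pi)
  rw [integral_exp_neg_sq_Ioi, show 2 / √Real.pi * (√Real.pi / 2) = 1 by
    have : 0 < √Real.pi := Real.sqrt_pos.2 Real.pi_pos
    field_simp] at h
  exact h

lemma erf_neg (x : ℝ) : erf (-x) = -erf x := by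
  have h := intervalIntegral.integral_comp_neg (a := 0) (b := x) fun t : ℝ => Real.exp (-t ^ 2)
  simp only [even_two, Even.neg_pow, neg_zero] at h
  rw [erf, erf, intervalIntegral.integral_symm, ← h]
  ring

lemma tendsto_erf_atBot : Tendsto erf atBot (𝓝 (-1)) := by
  have h := (tendsto_erf_atTop.comp tendsto_neg_atBot_atTop).neg
  exact h.congr fun x => by simp [erf_neg]

/-- `(2/√π) ∫₀^∞ exp (-x² - a²/x²) dx = exp (-2a)`. -/
lemma integral_exp_neg_sq_sub_div_sq {a : ℝ} (ha : 0 < a) :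
    ∫ x in Set.Ioi (0 : ℝ), 2 / √Real.pi * Real.exp (-x ^ 2) * Real.exp (-(a / x) ^ 2) =
      Real.exp (-(2 * a)) := by
  -- An antiderivative, found from `-x² - a²/x² = -(x ± a/x)² ± 2a`: the unwanted `a / x²` terms of
  -- the two summands cancel.
  set A : ℝ → ℝ := fun x => (Real.exp (2 * a) * erf (x + a / x) +
    Real.exp (-(2 * a)) * erf (x - a / x)) / 2 with hA_def
  have hderiv : ∀ x, 0 < x →
      HasDerivAt A (2 / √Real.pi * Real.exp (-x ^ 2) * Real.exp (-(a / x) ^ 2)) x := fun x hx => by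
    have hd : HasDerivAt (fun x : ℝ => a / x) (-(a / x ^ 2)) x := by
      have := (hasDerivAt_inv hx.ne').const_mul a
      simpa [div_eq_mul_inv] using this
    have h1 := (hasDerivAt_erf (x + a / x)).comp x ((hasDerivAt_id x).add hd)
    have h2 := (hasDerivAt_erf (x - a / x)).comp x ((hasDerivAt_id x).sub hd)
    have h := ((h1.const_mul (Real.exp (2 * a))).add
      (h2.const_mul (Real.exp (-(2 * a))))).div_const 2
    refine h.congr_deriv ?_
    have e1 : Real.exp (2 * a) * Real.exp (-(x + a / x) ^ 2) =
        Real.exp (-x ^ 2) * Real.exp (-(a / x) ^ 2) := by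
      rw [← Real.exp_add, ← Real.exp_add]; congr 1; field_simp; ring
    have e2 : Real.exp (-(2 * a)) * Real.exp (-(x - a / x) ^ 2) =
        Real.exp (-x ^ 2) * Real.exp (-(a / x) ^ 2) := by
      rw [← Real.exp_add, ← Real.exp_add]; congr 1; field_simp; ring
    linear_combination (1 / √Real.pi * (1 - a / x ^ 2)) * e1 +
      (1 / √Real.pi * (1 + a / x ^ 2)) * e2
  have hdiv : Tendsto (fun x : ℝ => a / x) (𝓝[>] 0) atTop := by
    simpa [div_eq_mul_inv] using tendsto_inv_nhdsGT_zero.const_mul_atTop ha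
  have hid : Tendsto (fun x : ℝ => x) (𝓝[>] 0) (𝓝 0) := tendsto_id.mono_left nhdsWithin_le_nhds
  have hdiv' : Tendsto (fun x : ℝ => a / x) atTop (𝓝 0) := tendsto_const_nhds.div_atTop tendsto_id
  have hzero : Tendsto A (𝓝[>] 0) (𝓝 ((Real.exp (2 * a) - Real.exp (-(2 * a))) / 2)) := by
    have h1 := tendsto_erf_atTop.comp (hid.add_atTop hdiv)
    have h2 := tendsto_erf_atBot.comp (hid.add_atBot (tendsto_neg_atTop_atBot.comp hdiv))
    have := ((h1.const_mul (Real.exp (2 * a))).add (h2.const_mul (Real.exp (-(2 * a))))).div_const 2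
    rw [show (Real.exp (2 * a) - Real.exp (-(2 * a))) / 2 =
      (Real.exp (2 * a) * 1 + Real.exp (-(2 * a)) * -1) / 2 by ring]
    exact this.congr fun x => by simp [hA_def, sub_eq_add_neg]
  have htop : Tendsto A atTop (𝓝 ((Real.exp (2 * a) + Real.exp (-(2 * a))) / 2)) := by
    have h1 := tendsto_erf_atTop.comp (tendsto_id.atTop_add hdiv')
    have h2 := tendsto_erf_atTop.comp (tendsto_id.atTop_add hdiv'.neg)
    have := ((h1.const_mul (Real.exp (2 * a))).add (h2.const_mul (Real.exp (-(2 * a))))).div_const 2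
    rw [show (Real.exp (2 * a) + Real.exp (-(2 * a))) / 2 =
      (Real.exp (2 * a) * 1 + Real.exp (-(2 * a)) * 1) / 2 by ring]
    exact this.congr fun x => by simp [hA_def, sub_eq_add_neg]
  -- With `a / 0 = 0` the value `A 0` is not the right limit of `A` at `0`, so it is replaced by
  -- that limit.
  set B : ℝ → ℝ := Function.update A 0 ((Real.exp (2 * a) - Real.exp (-(2 * a))) / 2) with hB_def
  have hBA : ∀ x, x ≠ 0 → B =ᶠ[𝓝 x] A := fun x hx => by
    filter_upwards [isOpen_ne.mem_nhds hx] with y hy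
    exact Function.update_of_ne hy _ _
  have hcont : ContinuousWithinAt B (Set.Ici 0) 0 := by
    rw [hB_def, continuousWithinAt_update_same, Set.Ici_sdiff_left]
    exact hzero
  have hBtop : Tendsto B atTop (𝓝 ((Real.exp (2 * a) + Real.exp (-(2 * a))) / 2)) := by
    refine htop.congr' ?_
    filter_upwards [eventually_ne_atTop 0] with y hy
    exact (Function.update_of_ne hy _ _).symm
  rw [integral_Ioi_of_hasDerivAt_of_nonneg hcont
    (fun x hx => (hderiv x hx).congr_of_eventuallyEq (hBA x (ne_of_gt hx)))
    (fun x _ => by positivity) hBtop, hB_def, Function.update_self]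
  ring

/-- The law of `|Z|/√2` for a standard normal variable `Z`. -/
noncomputable def halfGaussian : Measure ℝ :=
  (volume.restrict (Set.Ioi 0)).withDensity fun x =>
    ENNReal.ofReal (2 / √Real.pi * Real.exp (-x ^ 2))

lemma integral_halfGaussian (f : ℝ → ℝ) : ∫ x, f x ∂halfGaussian =
    ∫ x in Set.Ioi (0 : ℝ), 2 / √Real.pi * Real.exp (-x ^ 2) * f x := by
  rw [halfGaussian, integral_withDensity_eq_integral_toReal_smul (by fun_prop)
    (ae_of_all _ fun x => ENNReal.ofReal_lt_top)]
  refine integral_congr_ae (ae_of_all _ fun x => ?_)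
  simp only [smul_eq_mul]
  rw [ENNReal.toReal_ofReal (by positivity)]

lemma halfGaussian_Iic {z : ℝ} (hz : 0 ≤ z) :
    halfGaussian (Set.Iic z) = ENNReal.ofReal (erf z) := by
  have hc : Continuous fun x : ℝ => 2 / √Real.pi * Real.exp (-x ^ 2) := by fun_prop
  rw [halfGaussian, withDensity_apply _ measurableSet_Iic, Measure.restrict_restrict
    measurableSet_Iic, Set.inter_comm, Set.Ioi_inter_Iic, erf,
    ← intervalIntegral.integral_const_mul, intervalIntegral.integral_of_le hz,
    ofReal_integral_eq_lintegral_ofReal hc.integrableOn_Ioc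
      (ae_of_all _ fun x => by simp only [Pi.zero_apply]; positivity)]

instance : IsProbabilityMeasure halfGaussian := by
  constructor
  refine tendsto_nhds_unique (tendsto_measure_Iic_atTop halfGaussian) ?_
  have h : Tendsto (fun z => ENNReal.ofReal (erf z)) atTop (𝓝 1) := by
    simpa using ENNReal.tendsto_ofReal tendsto_erf_atTop
  refine h.congr' ?_
  filter_upwards [eventually_ge_atTop 0] with z hz using (halfGaussian_Iic hz).symm

lemma halfGaussian_ae_pos : ∀ᵐ x ∂halfGaussian, 0 < x :=
  (withDensity_absolutelyContinuous _ _).ae_le (ae_restrict_mem measurableSet_Ioi)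

/-- Laplace transform of the one-sided stable law of index `1/2`. -/
lemma integral_exp_neg_mul_sq_div_halfGaussian {K s : ℝ} (hK : 0 < K) (hs : 0 < s) :
    ∫ x, Real.exp (-(s * (K / (2 * x)) ^ 2)) ∂halfGaussian =
      Real.exp (-(K * s ^ (1 / 2 : ℝ))) := by
  -- The parameter solves `s (K / (2x))² = (a / x)²`, so that `2a = K √s`.
  have h := integral_exp_neg_sq_sub_div_sq (a := K * √s / 2) (by positivity)
  have hx : ∀ x : ℝ, s * (K / (2 * x)) ^ 2 = (K * √s / 2 / x) ^ 2 := fun x => by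
    rw [div_pow, div_pow, div_pow, mul_pow, mul_pow, Real.sq_sqrt hs.le]
    ring
  simp_rw [integral_halfGaussian, ← Real.sqrt_eq_rpow, hx]
  rw [h]
  congr 2
  ring

/-- For `x > 0` the event reads `x > K / (2√t)`, a half-Gaussian tail. -/
lemma halfGaussian_sq_div_lt {K t : ℝ} (hK : 0 < K) (ht : 0 < t) :
    halfGaussian.real {x | (K / (2 * x)) ^ 2 < t} = 1 - erf (K / (2 * √t)) := by
  have hz : 0 ≤ K / (2 * √t) := by positivity
  have hst : 0 < √t := Real.sqrt_pos.2 ht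
  have hset : {x : ℝ | (K / (2 * x)) ^ 2 < t} =ᵐ[halfGaussian] Set.Ioi (K / (2 * √t)) := by
    filter_upwards [halfGaussian_ae_pos] with x hx
    refine propext ?_
    change (K / (2 * x)) ^ 2 < t ↔ K / (2 * √t) < x
    rw [← Real.lt_sqrt (by positivity), div_lt_iff₀ (by positivity), div_lt_iff₀ (by positivity)]
    constructor <;> intro h <;> linarith
  have herf : 0 ≤ erf (K / (2 * √t)) := by
    rw [erf]
    exact mul_nonneg (by positivity)
      (intervalIntegral.integral_nonneg hz fun x _ => (Real.exp_pos _).le)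
  rw [measureReal_congr hset, ← Set.compl_Iic, probReal_compl_eq_one_sub measurableSet_Iic, measureReal_def,
    halfGaussian_Iic hz, ENNReal.toReal_ofReal herf]

/-! ### From the signal to coverage -/

section Network

variable {Ω : Type*} [MeasurableSpace Ω] {μ : Measure Ω} [IsProbabilityMeasure μ]
  {X : ℕ → Ω → Plane} {Θ : ℕ → Ω → ℝ} {LoS : ℕ → Ω → Bool} {G : ℕ → Ω → ℝ} {ν : Measure ℝ}
  {lam c₁ c₂ : ℝ} {N : ℕ}

/-- The total received signal is almost surely finite. -/
lemma IsAPILNetwork.shotSignal_ne_top (hnet : IsAPILNetwork μ X Θ LoS G ν lam c₁ c₂ N)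
    (hlam : 0 < lam) (hc₂ : 0 < c₂) (hN : 1 ≤ N) {α ℓ : ℝ} (hα : 2 < α)
    (hℓ : ℓ ∈ Set.Icc (0 : ℝ) 1) : ∀ᵐ w ∂μ, shotSignal X Θ LoS G α ℓ w ≠ ∞ := by
  have hm := hnet.measurable_shotSignal α ℓ
  have hset : MeasurableSet {w | shotSignal X Θ LoS G α ℓ w ≠ ∞} :=
    (hm (measurableSet_singleton ∞)).compl
  -- Where the signal is infinite, `e^{-s∞} = 0`, so the Laplace transform bounds the probability of
  -- finiteness from below; it tends to `1` as `s → 0+`.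
  have hle : ∀ s : ℝ, 0 < s →
      ENNReal.ofReal (Real.exp (-(signalScale ν lam c₁ c₂ α ℓ N * s ^ (2 / α)))) ≤
        μ {w | shotSignal X Θ LoS G α ℓ w ≠ ∞} := fun s hs => by
    rw [← hnet.lintegral_expNeg_shotSignal hlam hc₂ hN hα hℓ hs, ← lintegral_indicator_one hset]
    refine lintegral_mono fun w => ?_
    by_cases hw : shotSignal X Θ LoS G α ℓ w = ∞
    · simp [hw, ENNReal.mul_top, hs]
    · rw [Set.indicator_of_mem (show w ∈ {w | shotSignal X Θ LoS G α ℓ w ≠ ∞} from hw)]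
      exact expNeg_le_one _
  have hlim : Tendsto (fun s : ℝ =>
      ENNReal.ofReal (Real.exp (-(signalScale ν lam c₁ c₂ α ℓ N * s ^ (2 / α)))))
      (𝓝[>] 0) (𝓝 1) := by
    have hδ : 0 < 2 / α := by positivity
    have hc : Continuous fun s : ℝ =>
        ENNReal.ofReal (Real.exp (-(signalScale ν lam c₁ c₂ α ℓ N * s ^ (2 / α)))) := by
      have := Real.continuous_rpow_const hδ.le
      exact ENNReal.continuous_ofReal.comp (by fun_prop)
    have := (hc.tendsto 0).mono_left (nhdsWithin_le_nhds (s := Set.Ioi 0))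
    simpa [Real.zero_rpow hδ.ne'] using this
  have h1 : 1 ≤ μ {w | shotSignal X Θ LoS G α ℓ w ≠ ∞} := by
    refine le_of_tendsto hlim ?_
    filter_upwards [self_mem_nhdsWithin] with s hs using hle s hs
  exact (mem_ae_iff_prob_eq_one hset).2 (le_antisymm prob_le_one h1)

lemma IsAPILNetwork.integral_exp_neg_mul_shotSignal
    (hnet : IsAPILNetwork μ X Θ LoS G ν lam c₁ c₂ N)
    (hlam : 0 < lam) (hc₂ : 0 < c₂) (hN : 1 ≤ N) {α ℓ s : ℝ} (hα : 2 < α)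
    (hℓ : ℓ ∈ Set.Icc (0 : ℝ) 1) (hs : 0 < s) :
    ∫ w, Real.exp (-(s * (shotSignal X Θ LoS G α ℓ w).toReal)) ∂μ =
      Real.exp (-(signalScale ν lam c₁ c₂ α ℓ N * s ^ (2 / α))) := by
  have hm := (hnet.measurable_shotSignal α ℓ).ennreal_toReal
  rw [integral_eq_lintegral_of_nonneg_ae (ae_of_all _ fun w => (Real.exp_pos _).le)
    (Measurable.aestronglyMeasurable (by fun_prop)), ← ENNReal.toReal_ofReal (Real.exp_pos (-(signalScale _ _ _ _ _ _ _ * _))).le,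
    ← hnet.lintegral_expNeg_shotSignal hlam hc₂ hN hα hℓ hs]
  congr 1
  refine lintegral_congr_ae ?_
  filter_upwards [hnet.shotSignal_ne_top hlam hc₂ hN hα hℓ] with w hw
  rw [expNeg_of_ne_top (ENNReal.mul_ne_top ENNReal.ofReal_ne_top hw), ENNReal.toReal_mul,
    ENNReal.toReal_ofReal hs.le]

/-- Almost sure finiteness is essential here: an infinite signal is covered, whereas its `toReal` is
`0`. -/
lemma IsAPILNetwork.cellFreeCoverage_eq (hnet : IsAPILNetwork μ X Θ LoS G ν lam c₁ c₂ N)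
    (hlam : 0 < lam) (hc₂ : 0 < c₂) (hN : 1 ≤ N) {α ℓ P σ₀ β : ℝ} (hα : 2 < α)
    (hℓ : ℓ ∈ Set.Icc (0 : ℝ) 1) (hP : 0 < P) (hσ₀ : 0 < σ₀) :
    cellFreeCoverage μ X Θ LoS G α ℓ P σ₀ β =
      1 - μ.real {w | (shotSignal X Θ LoS G α ℓ w).toReal < β * σ₀ / P} := by
  have hm := hnet.measurable_shotSignal α ℓ
  rw [← probReal_compl_eq_one_sub (measurableSet_lt hm.ennreal_toReal measurable_const),
    cellFreeCoverage]
  refine measureReal_congr ?_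
  filter_upwards [hnet.shotSignal_ne_top hlam hc₂ hN hα hℓ] with w hw
  refine propext ?_
  change ENNReal.ofReal β ≤ ENNReal.ofReal P * shotSignal X Θ LoS G α ℓ w / ENNReal.ofReal σ₀ ↔
    ¬ (shotSignal X Θ LoS G α ℓ w).toReal < β * σ₀ / P
  rw [not_lt, div_le_iff₀ hP]
  conv_lhs => rw [← ENNReal.ofReal_toReal hw]
  rw [← ENNReal.ofReal_mul hP.le, ← ENNReal.ofReal_div_of_pos hσ₀,
    ENNReal.ofReal_le_ofReal_iff (by positivity), le_div_iff₀ hσ₀, mul_comm P]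

end Network

end UAV

theorem proposition2 {Ω : Type*} [MeasurableSpace Ω] (μ : Measure Ω) [IsProbabilityMeasure μ]
    (X : ℕ → Ω → UAV.Plane) (Θ : ℕ → Ω → ℝ) (LoS : ℕ → Ω → Bool) (G : ℕ → Ω → ℝ)
    (ν : Measure ℝ) (lam c₁ c₂ α ℓ P σ₀ β : ℝ) (N : ℕ)
    (hlam : 0 < lam) (hc₁ : 0 < c₁) (hc₂ : 0 < c₂) (hα : 2 < α) (hℓ : ℓ ∈ Set.Icc (0 : ℝ) 1)
    (hP : 0 < P) (hσ₀ : 0 < σ₀) (hβ : 0 < β) (hN : 1 ≤ N)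
    (hnet : UAV.IsAPILNetwork μ X Θ LoS G ν lam c₁ c₂ N) :
    (∃ v : ℝ,
      UAV.HasInverseLaplaceAt
        (fun s : ℂ => 1 / s * Complex.exp
          (-(((Real.pi * lam * UAV.omega ν c₁ c₂ α ℓ / (N - 1).factorial *
              Real.Gamma (N + 2 / α) * Real.Gamma (1 - 2 / α) : ℝ) : ℂ) *
            s ^ ((2 / α : ℝ) : ℂ))))
        0 (β * σ₀ / P) (v : ℂ) ∧
      UAV.cellFreeCoverage μ X Θ LoS G α ℓ P σ₀ β = 1 - v) ∧
    (α = 4 →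
      UAV.cellFreeCoverage μ X Θ LoS G α ℓ P σ₀ β =
        UAV.erf (Real.pi ^ (3 / 2 : ℝ) * lam * UAV.omega ν c₁ c₂ α ℓ /
          (2 * (N - 1).factorial) * √(P / (β * σ₀)) * Real.Gamma (N + 1 / 2))) := by
  have hprob : IsProbabilityMeasure ν :=
    (hnet.angle_law 0).isProbabilityMeasure_iff.1 inferInstance
  have hK := UAV.signalScale_pos (N := N) (c₁ := c₁) hlam hc₂ hα hℓ hnet.angle_mem
  have hδ : 2 / α ∈ Set.Ioo (0 : ℝ) 1 := ⟨by positivity, (div_lt_one (by linarith)).2 hα⟩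
  have ht : 0 < β * σ₀ / P := by positivity
  have hcov := hnet.cellFreeCoverage_eq hlam hc₂ hN (β := β) hα hℓ hP hσ₀
  have hinv := UAV.hasInverseLaplaceAt_stableTransform
    (hnet.measurable_shotSignal α ℓ).ennreal_toReal (ae_of_all _ fun w => ENNReal.toReal_nonneg)
    hK hδ (fun s hs => hnet.integral_exp_neg_mul_shotSignal hlam hc₂ hN hα hℓ hs) ht
  refine ⟨⟨_, hinv, hcov⟩, fun h4 => ?_⟩
  subst h4
  have hhalf : (2 : ℝ) / 4 = 1 / 2 := by norm_num
  rw [hhalf] at hinv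
  -- A model variable with the same Laplace transform `exp (-K √s)` and an explicit distribution
  -- function.
  have hinv' := UAV.hasInverseLaplaceAt_stableTransform (μ := UAV.halfGaussian)
    (Y := fun x => (UAV.signalScale ν lam c₁ c₂ 4 ℓ N / (2 * x)) ^ 2) (by fun_prop)
    (ae_of_all _ fun x => sq_nonneg _) hK (by norm_num)
    (fun s hs => UAV.integral_exp_neg_mul_sq_div_halfGaussian hK hs) ht
  -- Both distribution functions at `t` are limits of the same truncated Bromwich integrals, taken
  -- on the line `γ = 1`, hence equal.
  have heq := tendsto_nhds_unique (hinv.2 1 one_pos) (hinv'.2 1 one_pos)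
  rw [Complex.ofReal_inj, UAV.halfGaussian_sq_div_lt hK ht] at heq
  rw [hcov, heq, sub_sub_cancel]
  congr 1
  have hsq : √(P / (β * σ₀)) = 1 / √(β * σ₀ / P) := by
    rw [← inv_div, Real.sqrt_inv, one_div]
  have hpi : Real.pi ^ (3 / 2 : ℝ) = Real.pi * √Real.pi := by
    rw [Real.sqrt_eq_rpow, ← Real.rpow_one_add' Real.pi_pos.le (by norm_num)]
    norm_num
  -- In `K / (2√t)` the factor `Γ(1 - 1/2) = √π` turns `π` into `π^{3/2}`.
  rw [UAV.signalScale, hsq, hpi, hhalf, show (1 : ℝ) - 1 / 2 = 1 / 2 by norm_num,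
    Real.Gamma_one_half_eq]
  have hst : 0 < √(β * σ₀ / P) := Real.sqrt_pos.2 ht
  field_simp
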